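/- Let $X=\{x_0,x_1,x_2,\dots\}$ be an infinite set of variables. A terminal-free pattern is a nonempty string $\alpha$ over $X$; for a finite alphabet $\Sigma$ its pattern language is $$L_\Sigma(\alpha)=\{\sigma(\alpha)\mid \sigma:X^*\to\Sigma^*\text{ a morphism}\}$$ (variables may be replaced by the empty word). The variable distance $\mathrm{vd}(\alpha)$ is the smallest $k\ge 0$ such that, for every variable $x$ and every factorisation $\alpha=\beta\,x\,\gamma\,x\,\delta$ in which $x$ does not occur in $\gamma$, at most $k$ different variables occur in $\gamma$. Time is the number of steps of a random access machine with indirect addressing whose arithmetic operations are addition and truncated subtraction of natural numbers, each instruction taking one step. The input $(\alpha,w)$ is given by the lengths $|\alpha|,|w|$ and the sequences of the indices of the variables of $\alpha$ and of the letters of $w$, where $\Sigma=\{0,\dots,s-1\}$. Theorem. There is a single random access machine program that, given any terminal-free pattern $\alpha$ and any word $w$ over any finite alphabet $\Sigma$, decides whether $w\in L_\Sigma(\alpha)$, and there is a constant $C$ such that for all such $\alpha$ and $w$ it takes at most $$C\,|\alpha|^3\,\max(1,|w|)^{\mathrm{vd}(\alpha)+4}$$ steps, and every number held in a register or memory cell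 during the computation is at most $N^{C(\mathrm{vd}(\alpha)+1)}$ whenever $N\ge 2$ bounds all numbers of the input (that is, words of $O((\mathrm{vd}(\alpha)+1)\log N)$ bits suffice). Consequently, the membership problem is solvable in polynomial time for every class of terminal-free patterns of bounded variable distance: for every $k$ there is a $d$ such that, on all inputs with $\mathrm{vd}(\alpha)\le k$, the same program takes at most $d\,(|\alpha|+|w|)^d$ steps and uses only numbers up to $N^d$, with $N$ as above. -/

import Mathlib

/-! ### Terminal-free patterns

Variables are natural numbers, a terminal-free pattern is a nonempty `List ℕ`, and a word over the
alphabet `S` is a `List S`. -/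

/-- The (terminal-free, erasing) pattern language of `α` over the alphabet `S`: all images of `α`
under morphisms from strings of variables to words. -/
def patternLanguage (S : Type*) (α : List ℕ) : Set (List S) :=
  {w | ∃ σ : List ℕ → List S, (∀ u v, σ (u ++ v) = σ u ++ σ v) ∧ σ α = w}

/-- `k` bounds the number of different variables between any two consecutive occurrences of the
same variable in `α`. -/
def SeparatesAtMost (α : List ℕ) (k : ℕ) : Prop :=
  ∀ (x : ℕ) (β γ δ : List ℕ), α = β ++ [x] ++ γ ++ [x] ++ δ → x ∉ γ → γ.toFinset.card ≤ k

/-- The variable distance: the least `k` as in `SeparatesAtMost`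
(one exists, see `separatesAtMost_length`). -/
noncomputable def variableDistance (α : List ℕ) : ℕ :=
  sInf {k | SeparatesAtMost α k}

theorem separatesAtMost_length (α : List ℕ) : SeparatesAtMost α α.length := by
  rintro x β γ δ rfl _
  have := γ.toFinset_card_le
  simp only [List.length_append]
  omega

/-! ### Random access machines

A program is a finite list of instructions. It works on registers, which are named directly by the
instructions (so a program uses only finitely many of them), and on a memory, whose cells are
addressed by the contents of registers. Every instruction takes one unit of time; the only
arithmetic operations are addition and truncated subtraction. -/

namespace RAM

inductive Instr where
  /-- `reg i := c` -/
  | const (i c : ℕ)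
  /-- `reg i := reg j` -/
  | move (i j : ℕ)
  /-- `reg i := reg j + reg k` -/
  | add (i j k : ℕ)
  /-- `reg i := reg j - reg k` (zero if `reg j < reg k`) -/
  | sub (i j k : ℕ)
  /-- `reg i := mem (reg j)` -/
  | load (i j : ℕ)
  /-- `mem (reg i) := reg j` -/
  | store (i j : ℕ)
  /-- continue with instruction number `l` -/
  | jump (l : ℕ)
  /-- continue with instruction number `l` if `reg i = 0`, else with the next instruction -/
  | jumpIfZero (i l : ℕ)

abbrev Program := List Instr

structure Config where
  /-- number of the instruction to be executed next -/
  pc : ℕ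
  reg : ℕ → ℕ
  mem : ℕ → ℕ

/-- Write `v` into register `i` and go to the next instruction. -/
def Config.setReg (c : Config) (i v : ℕ) : Config :=
  { c with pc := c.pc + 1, reg := Function.update c.reg i v }

def Instr.exec (c : Config) : Instr → Config
  | .const i a => c.setReg i a
  | .move i j => c.setReg i (c.reg j)
  | .add i j k => c.setReg i (c.reg j + c.reg k)
  | .sub i j k => c.setReg i (c.reg j - c.reg k)
  | .load i j => c.setReg i (c.mem (c.reg j))
  | .store i j => { c with pc := c.pc + 1, mem := Function.update c.mem (c.reg i) (c.reg j) }
  | .jump l => { c with pc := l }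
  | .jumpIfZero i l => { c with pc := if c.reg i = 0 then l else c.pc + 1 }

/-- A computation halts when the instruction pointer leaves the program. -/
def Halted (P : Program) (c : Config) : Prop := P.length ≤ c.pc

/-- One step; halted configurations do not change. -/
def step (P : Program) (c : Config) : Config :=
  match P[c.pc]? with
  | some I => I.exec c
  | none => c

/-- The configuration reached after `t` steps. -/
def run (P : Program) (c : Config) (t : ℕ) : Config := (step P)^[t] c

/-- Started in `c`, the program `P` halts after at most `T` steps with `out` in register `0`, and
at no time during the computation does a register or memory cell hold a number above `B`. -/
def OutputsWithin (P : Program) (c : Config) (out T B : ℕ) : Prop :=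
  ∃ t ≤ T, Halted P (run P c t) ∧ (run P c t).reg 0 = out ∧
    ∀ s ≤ t, ∀ a, (run P c s).reg a ≤ B ∧ (run P c s).mem a ≤ B

/-- The initial configuration on input `(u, v)`: registers `0` and `1` hold the two lengths, the
memory holds the entries of `u` followed by those of `v`, and everything else is `0`. -/
def init (u v : List ℕ) : Config where
  pc := 0
  reg := fun i => if i = 0 then u.length else if i = 1 then v.length else 0
  mem := fun a => (u ++ v).getD a 0

end RAM

/-- Every number occurring in the input `(u, v)`, including the two lengths, is at most `N`. -/
def InputBoundedBy (u v : List ℕ) (N : ℕ) : Prop :=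
  u.length ≤ N ∧ v.length ≤ N ∧ (∀ x ∈ u, x ≤ N) ∧ ∀ a ∈ v, a ≤ N

/-- The word `w` over the alphabet `{0, …, s - 1}` as the machine receives it. -/
def wordCode {s : ℕ} (w : List (Fin s)) : List ℕ := w.map Fin.val

open Classical in
/-- On input `(α, w)`, where `w` is a word over an alphabet with `s` letters, the program `P`
decides whether `w ∈ L(α)` (answer `1` for yes, `0` for no) in at most `T` steps, using only
numbers up to `B`. -/
def DecidesMembershipWithin (P : RAM.Program) (α : List ℕ) {s : ℕ} (w : List (Fin s))
    (T B : ℕ) : Prop :=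
  RAM.OutputsWithin P (RAM.init α (wordCode w))
    (if w ∈ patternLanguage (Fin s) α then 1 else 0) T B

/-! Write n = |α| and m = |w|. A substitution with image w amounts to cuts 0 = p 0 ≤ … ≤ p n = m of
w in which places carrying the same variable receive equal factors (`exists_isSolution_iff`). A
depth-first search builds such cuts from left to right. For the continuation of a partial cut p 0,
…, p i only the position p i matters, together with the images of the variables that occur both
before and after the cut i.

The key of a partial cut (`cutKey`) records these data economically. Among the first i places, let j
be the earliest last occurrence of a variable that is needed again. The key stores i, p i and the
slice lengths at all last occurrences from j on. By consistency these give every slice length from j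
on, and counting back from p i recovers the cuts themselves, hence the images as factors of w. So
partial cuts with equal keys can be continued in the same way (`Consistent.exchange`).

The stored places after j carry different variables and all lie before the next occurrence of the
variable at j. Hence at most vd(α) + 1 lengths are stored (`length_digits_le`). They belong to
disjoint factors of w, so their sum is at most m and a binomial coefficient counts them. Counting
each length separately would give (m + 1)^(vd(α) + 1), which for short words exceeds the claimed
bound with a uniform constant (`card_keySet_le_pow`).

The search never extends two partial cuts with the same key (`SearchInv`), and each key accounts for
O(m) rounds (`searchMeasure`). A round costs O(nm), with products formed by repeated addition. The
table of known keys is the memory itself, addressed by the key, and its initial zeros represent the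
empty table.

For the machine model, a small structured language is compiled to instructions; `Triple` is a Hoare
triple that also bounds the time and the numbers that occur. -/

namespace RAM

/-! ### A structured language -/

/-- The variables of the structured language. -/
inductive Var where
  | patLen | wordLen | lvl | ptr | nxt | code | acc | cnt | flag | bad | fst | cur | prev | ref
  | ans
  deriving DecidableEq

/-- The register that holds a variable. -/
def Var.idx : Var → ℕ
  | .patLen => 0 | .wordLen => 1 | .lvl => 2 | .ptr => 3 | .nxt => 4 | .code => 5 | .acc => 6
  | .cnt => 7 | .flag => 8 | .bad => 9 | .fst => 10 | .cur => 11 | .prev => 12 | .ref => 13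
  | .ans => 14

theorem Var.idx_lt (v : Var) : v.idx < 15 := by cases v <;> simp [Var.idx]

theorem Var.idx_injective : Function.Injective Var.idx := by
  intro u v h
  cases u <;> cases v <;> first | rfl | simp [Var.idx] at h

structure Store where
  reg : Var → ℕ
  mem : ℕ → ℕ

def Store.set (s : Store) (v : Var) (x : ℕ) : Store := { s with reg := Function.update s.reg v x }

def Store.put (s : Store) (a x : ℕ) : Store := { s with mem := Function.update s.mem a x }

@[simp] theorem Store.set_mem (s : Store) (v : Var) (x : ℕ) : (s.set v x).mem = s.mem := rfl

@[simp] theorem Store.put_reg (s : Store) (a x : ℕ) : (s.put a x).reg = s.reg := rfl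

@[simp] theorem Store.set_reg (s : Store) (v : Var) (x : ℕ) (u : Var) :
    (s.set v x).reg u = if u = v then x else s.reg u := by
  simp [Store.set, Function.update_apply]

@[simp] theorem Store.put_mem (s : Store) (a x b : ℕ) :
    (s.put a x).mem b = if b = a then x else s.mem b := by
  simp [Store.put, Function.update_apply]

inductive Expr where
  | const (c : ℕ)
  | var (v : Var)
  | add (e f : Expr)
  | sub (e f : Expr)
  /-- the distance of two numbers -/
  | dist (e f : Expr)
  | load (e : Expr)

namespace Expr

def eval (s : Store) : Expr → ℕ
  | const c => c
  | var v => s.reg v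
  | add e f => e.eval s + f.eval s
  | sub e f => e.eval s - f.eval s
  | dist e f => (e.eval s - f.eval s) + (f.eval s - e.eval s)
  | load e => s.mem (e.eval s)

/-- Evaluation in a store with entries up to `B` produces no intermediate result above `B`. -/
def Safe (B : ℕ) (s : Store) : Expr → Prop
  | const c => c ≤ B
  | var _ => True
  | add e f => e.Safe B s ∧ f.Safe B s ∧ e.eval s + f.eval s ≤ B
  | sub e f => e.Safe B s ∧ f.Safe B s
  | dist e f => e.Safe B s ∧ f.Safe B s
  | load e => e.Safe B s

def size : Expr → ℕ
  | const _ => 1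
  | var _ => 1
  | add e f => e.size + f.size + 1
  | sub e f => e.size + f.size + 1
  | dist e f => e.size + f.size + 3
  | load e => e.size + 1

/-- Code that leaves the value of an expression in register `d` and does not touch the registers
below `d`. -/
def code : Expr → ℕ → List Instr
  | const c, d => [.const d c]
  | var v, d => [.move d v.idx]
  | add e f, d => e.code d ++ f.code (d + 1) ++ [.add d d (d + 1)]
  | sub e f, d => e.code d ++ f.code (d + 1) ++ [.sub d d (d + 1)]
  | dist e f, d => e.code d ++ f.code (d + 1) ++
      [.sub (d + 2) d (d + 1), .sub d (d + 1) d, .add d d (d + 2)]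
  | load e, d => e.code d ++ [.load d d]

@[simp] theorem length_code (e : Expr) (d : ℕ) : (e.code d).length = e.size := by
  induction e generalizing d <;> simp [code, size, Nat.add_assoc, *]

end Expr

inductive Cmd where
  | assign (v : Var) (e : Expr)
  | store (e f : Expr)
  | seq (c d : Cmd)
  /-- the first branch is taken if the value is not zero -/
  | ite (e : Expr) (c d : Cmd)
  /-- repeat while the value is not zero -/
  | loop (e : Expr) (c : Cmd)

namespace Cmd

def size : Cmd → ℕ
  | assign _ e => e.size + 1
  | store e f => e.size + f.size + 1
  | seq c d => c.size + d.size
  | ite e c d => e.size + 1 + c.size + 1 + d.size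
  | loop e c => e.size + 1 + c.size + 1

/-- Compiled code, to be placed at address `o`. -/
def code : Cmd → ℕ → List Instr
  | assign v e, _ => e.code 15 ++ [.move v.idx 15]
  | store e f, _ => e.code 15 ++ (f.code 16 ++ [.store 15 16])
  | seq c d, o => c.code o ++ d.code (o + c.size)
  | ite e c d, o => e.code 15 ++ (.jumpIfZero 15 (o + e.size + 1 + c.size + 1) ::
      (c.code (o + e.size + 1) ++ (.jump (o + e.size + 1 + c.size + 1 + d.size) ::
        d.code (o + e.size + 1 + c.size + 1))))
  | loop e c, o => e.code 15 ++ (.jumpIfZero 15 (o + e.size + 1 + c.size + 1) ::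
      (c.code (o + e.size + 1) ++ [.jump o]))

@[simp] theorem length_code (c : Cmd) (o : ℕ) : (c.code o).length = c.size := by
  induction c generalizing o <;> simp [code, size, *] <;> omega

end Cmd

/-! ### Computations -/

/-- The list `l` of instructions stands at address `o` of the program. -/
def CodeAt (P : Program) : ℕ → List Instr → Prop
  | _, [] => True
  | o, I :: l => P[o]? = some I ∧ CodeAt P (o + 1) l

theorem codeAt_append {P : Program} {o : ℕ} {l l' : List Instr} :
    CodeAt P o (l ++ l') ↔ CodeAt P o l ∧ CodeAt P (o + l.length) l' := by
  induction l generalizing o with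
  | nil => simp [CodeAt]
  | cons I l ih => simp [CodeAt, ih, and_assoc, Nat.add_assoc, Nat.add_comm 1]

theorem codeAt_length_append (l l' : List Instr) : CodeAt (l ++ l') l.length l' := by
  induction l' generalizing l with
  | nil => trivial
  | cons I l' ih => exact ⟨by simp, by simpa using ih (l ++ [I])⟩

theorem codeAt_self (P : Program) : CodeAt P 0 P := codeAt_length_append [] P

def Config.Bounded (B : ℕ) (x : Config) : Prop := ∀ a, x.reg a ≤ B ∧ x.mem a ≤ B

/-- `y` is reached from `x` in `t` steps, through configurations bounded by `B`. -/
def Reaches (P : Program) (B : ℕ) (x : Config) (t : ℕ) (y : Config) : Prop :=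
  run P x t = y ∧ ∀ u ≤ t, (run P x u).Bounded B

theorem Reaches.refl {P : Program} {B : ℕ} {x : Config} (h : x.Bounded B) :
    Reaches P B x 0 x :=
  ⟨rfl, fun u hu => by obtain rfl : u = 0 := by omega
                       exact h⟩

theorem Reaches.trans {P : Program} {B : ℕ} {x y z : Config} {t u : ℕ}
    (h : Reaches P B x t y) (h' : Reaches P B y u z) : Reaches P B x (t + u) z := by
  have key : ∀ k, run P x (t + k) = run P y k := by
    intro k
    rw [← h.1, run, run, run, Nat.add_comm, Function.iterate_add_apply]
  refine ⟨by rw [key, h'.1], fun k hk => ?_⟩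
  rcases le_total k t with hkt | hkt
  · exact h.2 k hkt
  · obtain ⟨j, rfl⟩ := Nat.exists_eq_add_of_le hkt
    rw [key]
    exact h'.2 j (by omega)

theorem Reaches.right_bounded {P : Program} {B : ℕ} {x y : Config} {t : ℕ}
    (h : Reaches P B x t y) : y.Bounded B := h.1 ▸ h.2 t le_rfl

theorem Reaches.single {P : Program} {B : ℕ} {x : Config} {I : Instr} (hI : P[x.pc]? = some I)
    (hx : x.Bounded B) (hy : (I.exec x).Bounded B) : Reaches P B x 1 (I.exec x) := by
  have h : step P x = I.exec x := by simp [step, hI]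
  refine ⟨h, fun u hu => ?_⟩
  interval_cases u
  · exact hx
  · rw [show run P x 1 = I.exec x from h]; exact hy

theorem Config.Bounded.setReg {B : ℕ} {x : Config} (h : x.Bounded B) {i v : ℕ} (hv : v ≤ B) :
    (x.setReg i v).Bounded B := by
  intro a
  refine ⟨?_, (h a).2⟩
  simp only [Config.setReg, Function.update_apply]
  split
  · exact hv
  · exact (h a).1

/-- The configuration holds the data of the store. -/
structure Config.Implements (x : Config) (s : Store) : Prop where
  reg : ∀ v : Var, x.reg v.idx = s.reg v
  mem : x.mem = s.mem

/-- The registers from `d` on serve as an evaluation stack: the second operand is evaluated at `d +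
1` and so cannot destroy the first. Registers below 15 hold the variables, whence `15 ≤ d`. -/
theorem Expr.code_reaches {P : Program} {B : ℕ} {s : Store} (e : Expr) {d : ℕ} (hd : 15 ≤ d)
    {x : Config} (hP : CodeAt P x.pc (e.code d)) (hs : x.Implements s) (hx : x.Bounded B)
    (he : e.Safe B s) :
    ∃ y, Reaches P B x e.size y ∧ y.pc = x.pc + e.size ∧ y.Implements s ∧
      (∀ r < d, y.reg r = x.reg r) ∧ y.reg d = e.eval s := by
  have impl : ∀ {z : Config} {i v : ℕ}, 15 ≤ i → z.Implements s →
      (z.setReg i v).Implements s := by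
    intro z i v hi hz
    refine ⟨fun u => ?_, hz.mem⟩
    have := u.idx_lt
    rw [← hz.reg u]
    exact Function.update_of_ne (by omega) _ _
  have binary : ∀ (e f : Expr) (l : List Instr) (x : Config),
      (∀ {d : ℕ}, 15 ≤ d → ∀ {x : Config}, CodeAt P x.pc (e.code d) → x.Implements s →
        x.Bounded B → e.Safe B s → ∃ y, Reaches P B x e.size y ∧ y.pc = x.pc + e.size ∧
          y.Implements s ∧ (∀ r < d, y.reg r = x.reg r) ∧ y.reg d = e.eval s) →
      (∀ {d : ℕ}, 15 ≤ d → ∀ {x : Config}, CodeAt P x.pc (f.code d) → x.Implements s →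
        x.Bounded B → f.Safe B s → ∃ y, Reaches P B x f.size y ∧ y.pc = x.pc + f.size ∧
          y.Implements s ∧ (∀ r < d, y.reg r = x.reg r) ∧ y.reg d = f.eval s) →
      ∀ {d : ℕ}, 15 ≤ d → CodeAt P x.pc (e.code d ++ f.code (d + 1) ++ l) → x.Implements s →
        x.Bounded B → e.Safe B s → f.Safe B s →
        ∃ y, Reaches P B x (e.size + f.size) y ∧ CodeAt P y.pc l ∧
          y.pc = x.pc + (e.size + f.size) ∧
          y.Implements s ∧ (∀ r < d, y.reg r = x.reg r) ∧ y.reg d = e.eval s ∧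
          y.reg (d + 1) = f.eval s := by
    intro e f l x ihe ihf d hd hP hs hx he hf
    simp only [codeAt_append, List.length_append, Expr.length_code] at hP
    obtain ⟨y, hy, hyp, hys, hyr, hyd⟩ := ihe hd hP.1.1 hs hx he
    obtain ⟨z, hz, hzp, hzs, hzr, hzd⟩ :=
      ihf (show 15 ≤ d + 1 by omega) (x := y) (by rw [hyp]; exact hP.1.2) hys hy.right_bounded hf
    have hpc : z.pc = x.pc + (e.size + f.size) := by omega
    exact ⟨z, hy.trans hz, hpc ▸ hP.2, hpc, hzs,
      fun r hr => by rw [hzr r (by omega), hyr r hr], by rw [hzr d (by omega), hyd], hzd⟩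
  induction e generalizing d x with
  | const c =>
    refine ⟨_, Reaches.single hP.1 hx (hx.setReg he), rfl, impl hd hs, fun r hr => ?_, ?_⟩
    · exact Function.update_of_ne (by omega) _ _
    · exact Function.update_self ..
  | var v =>
    refine ⟨_, Reaches.single hP.1 hx (hx.setReg (hx _).1), rfl, impl hd hs, fun r hr => ?_, ?_⟩
    · exact Function.update_of_ne (by omega) _ _
    · exact (Function.update_self ..).trans (hs.reg v)
  | load e ih =>
    simp only [code, codeAt_append, length_code] at hP
    obtain ⟨y, hy, hyp, hys, hyr, hyd⟩ := ih hd hP.1 hs hx he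
    rw [← hyp] at hP
    refine ⟨_, hy.trans (Reaches.single hP.2.1 hy.right_bounded
      (hy.right_bounded.setReg (hy.right_bounded _).2)), ?_, impl hd hys, fun r hr => ?_, ?_⟩
    · simp [Instr.exec, Config.setReg, hyp, size, Nat.add_assoc]
    · exact (Function.update_of_ne (by omega) _ _).trans (hyr r hr)
    · refine (Function.update_self ..).trans ?_
      rw [hyd, hys.mem, eval]
  | add e f ihe ihf =>
    obtain ⟨y, hy, hP', hyp, hys, hyr, hyd, hyd'⟩ := binary e f _ x ihe ihf hd hP hs hx he.1 he.2.1
    refine ⟨_, hy.trans (Reaches.single hP'.1 hy.right_bounded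
      (hy.right_bounded.setReg (by rw [hyd, hyd']; exact he.2.2))), ?_, impl hd hys,
      fun r hr => ?_, ?_⟩
    · simp [Instr.exec, Config.setReg, hyp, size, Nat.add_assoc]
    · exact (Function.update_of_ne (by omega) _ _).trans (hyr r hr)
    · refine (Function.update_self ..).trans ?_
      rw [hyd, hyd', eval]
  | sub e f ihe ihf =>
    obtain ⟨y, hy, hP', hyp, hys, hyr, hyd, hyd'⟩ := binary e f _ x ihe ihf hd hP hs hx he.1 he.2
    refine ⟨_, hy.trans (Reaches.single hP'.1 hy.right_bounded
      (hy.right_bounded.setReg ((Nat.sub_le _ _).trans (hy.right_bounded _).1))), ?_, impl hd hys,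
      fun r hr => ?_, ?_⟩
    · simp [Instr.exec, Config.setReg, hyp, size, Nat.add_assoc]
    · exact (Function.update_of_ne (by omega) _ _).trans (hyr r hr)
    · refine (Function.update_self ..).trans ?_
      rw [hyd, hyd', eval]
  | dist e f ihe ihf =>
    obtain ⟨y, hy, hP', hyp, hys, hyr, hyd, hyd'⟩ := binary e f _ x ihe ihf hd hP hs hx he.1 he.2
    have hy1 := (hy.right_bounded d).1
    have hy2 := (hy.right_bounded (d + 1)).1
    set z := y.setReg (d + 2) (y.reg d - y.reg (d + 1)) with hz
    have hzB : z.Bounded B := hy.right_bounded.setReg (by omega)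
    have hz0 : z.reg d = y.reg d := Function.update_of_ne (by omega) _ _
    have hz1 : z.reg (d + 1) = y.reg (d + 1) := Function.update_of_ne (by omega) _ _
    have hz2 : z.reg (d + 2) = y.reg d - y.reg (d + 1) := Function.update_self ..
    set z' := z.setReg d (z.reg (d + 1) - z.reg d) with hz'
    have hzB' : z'.Bounded B := hzB.setReg (by omega)
    have hz0' : z'.reg d = y.reg (d + 1) - y.reg d := by
      rw [← hz1, ← hz0]; exact Function.update_self ..
    have hz2' : z'.reg (d + 2) = y.reg d - y.reg (d + 1) := by
      rw [← hz2]; exact Function.update_of_ne (by omega) _ _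
    -- One of the two truncated differences is zero, so their sum does not exceed the larger
    -- operand.
    have hzB'' : (z'.setReg d (z'.reg d + z'.reg (d + 2))).Bounded B := hzB'.setReg (by omega)
    have r₁ : Reaches P B y 1 z := Reaches.single hP'.1 hy.right_bounded hzB
    have r₂ : Reaches P B z 1 z' :=
      Reaches.single (I := .sub d (d + 1) d) hP'.2.1 hzB hzB'
    have r₃ : Reaches P B z' 1 (z'.setReg d (z'.reg d + z'.reg (d + 2))) :=
      Reaches.single (I := .add d d (d + 2)) hP'.2.2.1 hzB' hzB''
    refine ⟨_, hy.trans (r₁.trans (r₂.trans r₃)), ?_,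
      impl hd (impl hd (impl (by omega) hys)), fun r hr => ?_, ?_⟩
    · simp [z', z, Config.setReg, hyp, size, Nat.add_assoc]
    · rw [← hyr r hr]
      exact (Function.update_of_ne (by omega) _ _).trans
        ((Function.update_of_ne (by omega) _ _).trans (Function.update_of_ne (by omega) _ _))
    · refine (Function.update_self ..).trans ?_
      rw [hz0', hz2', hyd, hyd', eval, Nat.add_comm]

/-! ### Triples -/

/-- Started in the store `s`, the compiled code of `c` ends after at most `T` steps in a store with
the property `Q`, and no number above `B` occurs. -/
def Triple (B : ℕ) (c : Cmd) (s : Store) (T : ℕ) (Q : Store → Prop) : Prop :=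
  ∀ (P : Program) (x : Config), CodeAt P x.pc (c.code x.pc) → x.Implements s → x.Bounded B →
    ∃ t ≤ T, ∃ y s', Reaches P B x t y ∧ y.pc = x.pc + c.size ∧ y.Implements s' ∧ Q s'

namespace Triple

variable {B : ℕ} {s : Store} {T : ℕ} {Q : Store → Prop}

theorem mono {c : Cmd} {T' : ℕ} {Q' : Store → Prop} (h : Triple B c s T' Q') (hT : T' ≤ T)
    (hQ : ∀ s', Q' s' → Q s') : Triple B c s T Q := by
  intro P x hP hs hx
  obtain ⟨t, ht, y, s', h1, h2, h3, h4⟩ := h P x hP hs hx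
  exact ⟨t, ht.trans hT, y, s', h1, h2, h3, hQ _ h4⟩

theorem assign {v : Var} {e : Expr} (he : e.Safe B s) (hT : e.size + 1 ≤ T)
    (hQ : Q (s.set v (e.eval s))) : Triple B (.assign v e) s T Q := by
  intro P x hP hs hx
  simp only [Cmd.code, codeAt_append, Expr.length_code] at hP
  obtain ⟨y, hy, hyp, hys, -, hyd⟩ := e.code_reaches le_rfl hP.1 hs hx he
  rw [← hyp] at hP
  have hyB := hy.right_bounded
  refine ⟨_, hT, _, s.set v (e.eval s),
    hy.trans (Reaches.single hP.2.1 hyB (hyB.setReg (hyB _).1)), ?_,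
    ⟨fun u => ?_, hys.mem⟩, hQ⟩
  · simp [Instr.exec, Config.setReg, hyp, Cmd.size, Nat.add_assoc]
  · rw [← hyd, Store.set_reg]
    simp only [Instr.exec, Config.setReg, Function.update_apply, Var.idx_injective.eq_iff, hys.reg]

theorem store {e f : Expr} (he : e.Safe B s) (hf : f.Safe B s) (hT : e.size + f.size + 1 ≤ T)
    (hQ : Q (s.put (e.eval s) (f.eval s))) : Triple B (.store e f) s T Q := by
  intro P x hP hs hx
  simp only [Cmd.code, codeAt_append, Expr.length_code] at hP
  obtain ⟨y, hy, hyp, hys, -, hyd⟩ := e.code_reaches le_rfl hP.1 hs hx he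
  rw [← hyp] at hP
  obtain ⟨z, hz, hzp, hzs, hzr, hzd⟩ := f.code_reaches (by norm_num) hP.2.1 hys hy.right_bounded hf
  rw [← hzp] at hP
  have hzB := hz.right_bounded
  rw [← hzr 15 (by norm_num)] at hyd
  refine ⟨_, hT, _, s.put (e.eval s) (f.eval s),
    (hy.trans hz).trans (Reaches.single hP.2.2.1 hzB fun a => ⟨(hzB a).1, ?_⟩),
    ?_, ⟨hzs.reg, ?_⟩, hQ⟩
  · simp only [Instr.exec, Function.update_apply]
    split
    · exact (hzB _).1
    · exact (hzB _).2
  · simp only [Instr.exec, Cmd.size]; omega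
  · simp only [Instr.exec, Store.put, hyd, hzd, hzs.mem]

theorem seq {c d : Cmd} {T₁ T₂ : ℕ} {R : Store → Prop} (h₁ : Triple B c s T₁ R)
    (h₂ : ∀ s', R s' → Triple B d s' T₂ Q) (hT : T₁ + T₂ ≤ T) : Triple B (.seq c d) s T Q := by
  intro P x hP hs hx
  simp only [Cmd.code, codeAt_append, Cmd.length_code] at hP
  obtain ⟨t, ht, y, s', hy, hyp, hys, hR⟩ := h₁ P x hP.1 hs hx
  rw [← hyp] at hP
  obtain ⟨u, hu, z, s'', hz, hzp, hzs, hQ⟩ := h₂ s' hR P y hP.2 hys hy.right_bounded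
  exact ⟨t + u, by omega, z, s'', hy.trans hz, by rw [hzp, hyp, Cmd.size, Nat.add_assoc], hzs, hQ⟩

/-- The store after an assignment is known exactly, so straight-line code can be executed
symbolically without intermediate assertions. -/
theorem assign_seq {v : Var} {e : Expr} {c : Cmd} (he : e.Safe B s) (hT : e.size + 1 ≤ T)
    (h : Triple B c (s.set v (e.eval s)) (T - (e.size + 1)) Q) :
    Triple B (.seq (.assign v e) c) s T Q :=
  seq (R := fun s' => s' = s.set v (e.eval s)) (assign he le_rfl rfl) (fun _ h' => h' ▸ h)
    (by omega)

theorem store_seq {e f : Expr} {c : Cmd} (he : e.Safe B s) (hf : f.Safe B s)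
    (hT : e.size + f.size + 1 ≤ T)
    (h : Triple B c (s.put (e.eval s) (f.eval s)) (T - (e.size + f.size + 1)) Q) :
    Triple B (.seq (.store e f) c) s T Q :=
  seq (R := fun s' => s' = s.put (e.eval s) (f.eval s)) (store he hf le_rfl rfl)
    (fun _ h' => h' ▸ h) (by omega)

theorem test {e : Expr} {P : Program} {x : Config} {l : ℕ} {o : List Instr}
    (hP : CodeAt P x.pc (e.code 15 ++ .jumpIfZero 15 l :: o)) (hs : x.Implements s)
    (hx : x.Bounded B) (he : e.Safe B s) :
    ∃ y, Reaches P B x (e.size + 1) y ∧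
      y.pc = (if e.eval s = 0 then l else x.pc + e.size + 1) ∧ y.Implements s ∧
      CodeAt P (x.pc + e.size + 1) o := by
  simp only [codeAt_append, Expr.length_code] at hP
  obtain ⟨y, hy, hyp, hys, -, hyd⟩ := e.code_reaches le_rfl hP.1 hs hx he
  rw [← hyp] at hP
  refine ⟨_, hy.trans (Reaches.single hP.2.1 hy.right_bounded hy.right_bounded), ?_,
    ⟨hys.reg, hys.mem⟩, hyp ▸ hP.2.2⟩
  simp only [Instr.exec, hyd, hyp]

theorem ite {e : Expr} {c d : Cmd} {T' : ℕ} (he : e.Safe B s)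
    (h₁ : e.eval s ≠ 0 → Triple B c s T' Q) (h₂ : e.eval s = 0 → Triple B d s T' Q)
    (hT : T' + (e.size + 2) ≤ T) : Triple B (.ite e c d) s T Q := by
  intro P x hP hs hx
  obtain ⟨y, hy, hyp, hys, hP⟩ := test hP hs hx he
  simp only [codeAt_append, Cmd.length_code, CodeAt] at hP
  by_cases h : e.eval s = 0
  · rw [if_pos h] at hyp
    obtain ⟨t, ht, z, s', hz, hzp, hzs, hQ⟩ := h₂ h P y (by rw [hyp]; exact hP.2.2) hys
      hy.right_bounded
    exact ⟨_, by omega, z, s', hy.trans hz, by rw [hzp, hyp, Cmd.size]; omega, hzs, hQ⟩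
  · rw [if_neg h] at hyp
    obtain ⟨t, ht, z, s', hz, hzp, hzs, hQ⟩ := h₁ h P y (by rw [hyp]; exact hP.1) hys
      hy.right_bounded
    rw [← hyp, ← hzp] at hP
    refine ⟨_, ?_, _, s', (hy.trans hz).trans
      (Reaches.single hP.2.1 hz.right_bounded hz.right_bounded), ?_, ⟨hzs.reg, hzs.mem⟩, hQ⟩
    · omega
    · simp only [Instr.exec, Cmd.size]; omega

/-- The index `k` of the invariant bounds the number of rounds. -/
theorem loop {e : Expr} {c : Cmd} {T' : ℕ} (I : ℕ → Store → Prop)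
    (he : ∀ k s, I k s → e.Safe B s)
    (h : ∀ k s, I k s → e.eval s ≠ 0 → Triple B c s T' (fun s' => ∃ k' < k, I k' s'))
    {k : ℕ} (hI : I k s) (hT : k * (T' + (e.size + 2)) + (e.size + 1) ≤ T)
    (hQ : ∀ k s, I k s → e.eval s = 0 → Q s) : Triple B (.loop e c) s T Q := by
  refine mono (Q' := Q) ?_ hT fun _ => id
  clear hT
  induction k using Nat.strong_induction_on generalizing s with
  | _ k ih =>
    intro P x hP hs hx
    obtain ⟨y, hy, hyp, hys, hP'⟩ := test hP hs hx (he k s hI)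
    simp only [codeAt_append, Cmd.length_code, CodeAt] at hP'
    by_cases h0 : e.eval s = 0
    · rw [if_pos h0] at hyp
      exact ⟨_, by omega, y, s, hy, by rw [hyp, Cmd.size]; omega, hys, hQ k s hI h0⟩
    · rw [if_neg h0] at hyp
      obtain ⟨t, ht, z, s', hz, hzp, hzs, k', hk', hI'⟩ := h k s hI h0 P y
        (by rw [hyp]; exact hP'.1) hys hy.right_bounded
      rw [← hyp, ← hzp] at hP'
      have hz' := Reaches.single hP'.2.1 hz.right_bounded hz.right_bounded
      obtain ⟨t', ht', z', s'', hz'', hzp', hzs', hQ'⟩ := ih k' hk' hI' P { z with pc := x.pc } hP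
        ⟨hzs.reg, hzs.mem⟩ hz'.right_bounded
      refine ⟨_, ?_, z', s'', ((hy.trans hz).trans hz').trans hz'', hzp', hzs', hQ'⟩
      -- The round just completed is paid for by the drop of the index from `k` to `k'`.
      have : (k' + 1) * (T' + (e.size + 2)) ≤ k * (T' + (e.size + 2)) :=
        Nat.mul_le_mul_right _ hk'
      rw [Nat.add_mul] at this
      omega

end Triple

end RAM

/-! ### Cutting a word along a pattern

A pattern of length `n` is given by a function `A`, a word by a function `W`, and a substitution by
the cut positions `p 0 ≤ p 1 ≤ …`: the `t`-th symbol of the pattern is replaced by the factor of the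
word between `p t` and `p (t + 1)`. -/

def SameSlice (W p : ℕ → ℕ) (s t : ℕ) : Prop :=
  p (s + 1) - p s = p (t + 1) - p t ∧ ∀ d < p (s + 1) - p s, W (p s + d) = W (p t + d)

theorem SameSlice.symm {W p : ℕ → ℕ} {s t : ℕ} (h : SameSlice W p s t) : SameSlice W p t s :=
  ⟨h.1.symm, fun d hd => (h.2 d (h.1 ▸ hd)).symm⟩

theorem SameSlice.trans {W p : ℕ → ℕ} {s t u : ℕ} (h : SameSlice W p s t)
    (h' : SameSlice W p t u) : SameSlice W p s u :=
  ⟨h.1.trans h'.1, fun d hd => (h.2 d hd).trans (h'.2 d (h.1 ▸ hd))⟩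

theorem SameSlice.congr {W p q : ℕ → ℕ} {s t : ℕ} (h : SameSlice W p s t) (h₁ : q s = p s)
    (h₂ : q (s + 1) = p (s + 1)) (h₃ : q t = p t) (h₄ : q (t + 1) = p (t + 1)) :
    SameSlice W q s t := by
  rw [SameSlice, h₁, h₂, h₃, h₄]; exact h

/-- The cuts `p 0, …, p i` are compatible with the first `i` symbols of the pattern. -/
structure Consistent (A W : ℕ → ℕ) (m i : ℕ) (p : ℕ → ℕ) : Prop where
  zero : p 0 = 0
  mono : ∀ t < i, p t ≤ p (t + 1)
  le : ∀ t ≤ i, p t ≤ m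
  same : ∀ s < i, ∀ t < i, A s = A t → SameSlice W p s t

section Cuts

variable {A W nx : ℕ → ℕ} {n m i : ℕ} {p q : ℕ → ℕ}

theorem Consistent.of_le {j : ℕ} (h : Consistent A W m i p) (hj : j ≤ i) :
    Consistent A W m j p :=
  ⟨h.zero, fun t ht => h.mono t (by omega), fun t ht => h.le t (by omega),
    fun s hs t ht => h.same s (by omega) t (by omega)⟩

theorem Consistent.congr (h : Consistent A W m i p) (hq : ∀ t ≤ i, q t = p t) :
    Consistent A W m i q := by
  refine ⟨(hq 0 (by omega)).trans h.zero, fun t ht => ?_, fun t ht => ?_, fun s hs t ht hst => ?_⟩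
  · rw [hq t (by omega), hq (t + 1) (by omega)]; exact h.mono t ht
  · rw [hq t ht]; exact h.le t ht
  · exact (h.same s hs t ht hst).congr (hq _ (by omega)) (hq _ (by omega)) (hq _ (by omega))
      (hq _ (by omega))

/-- It suffices to compare a new slice with the first occurrence of its variable. -/
theorem consistent_succ_iff {f : ℕ} (hf : f ≤ i) (hfA : A f = A i) (hf' : ∀ g < f, A g ≠ A i) :
    Consistent A W m (i + 1) p ↔
      Consistent A W m i p ∧ p i ≤ p (i + 1) ∧ p (i + 1) ≤ m ∧ SameSlice W p f i := by
  constructor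
  · intro h
    exact ⟨h.of_le (by omega), h.mono i (by omega), h.le _ le_rfl,
      h.same f (by omega) i (by omega) hfA⟩
  · rintro ⟨h, h1, h2, h3⟩
    have new : ∀ s ≤ i, A s = A i → SameSlice W p s i := by
      intro s hs hsA
      rcases hs.eq_or_lt with rfl | hs
      · exact ⟨rfl, fun _ _ => rfl⟩
      · have : f ≤ s := not_lt.1 fun hlt => hf' s hlt hsA
        exact (h.same s hs f (by omega) (hsA.trans hfA.symm)).trans h3
    refine ⟨h.zero, fun t ht => ?_, fun t ht => ?_, fun s hs t ht hst => ?_⟩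
    · rcases (Nat.lt_succ_iff.1 ht).eq_or_lt with rfl | ht
      exacts [h1, h.mono t ht]
    · rcases ht.eq_or_lt with rfl | ht
      exacts [h2, h.le t (by omega)]
    · rcases (Nat.lt_succ_iff.1 ht).eq_or_lt with rfl | ht
      · exact new s (by omega) hst
      · rcases (Nat.lt_succ_iff.1 hs).eq_or_lt with rfl | hs
        · exact (new t ht.le hst.symm).symm
        · exact h.same s hs t ht hst

/-! ### Next occurrences and keys of partial cuts -/

/-- `nx` gives the next occurrence of the same variable, or `n` after the last one. -/
def IsNext (A : ℕ → ℕ) (n : ℕ) (nx : ℕ → ℕ) : Prop :=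
  ∀ t < n, t < nx t ∧ nx t ≤ n ∧ (∀ v, t < v → v < nx t → A v ≠ A t) ∧ (nx t < n → A (nx t) = A t)

/-- Before `t` there is a last occurrence (with respect to the first `i` symbols) of a variable
that is still needed later. -/
def Opened (nx : ℕ → ℕ) (n i t : ℕ) : Prop := ∃ s < t, i ≤ nx s ∧ nx s < n

theorem opened_succ {t : ℕ} :
    Opened nx n i (t + 1) ↔ Opened nx n i t ∨ (i ≤ nx t ∧ nx t < n) := by
  constructor
  · rintro ⟨s, hs, h⟩
    rcases (Nat.lt_succ_iff.1 hs).eq_or_lt with rfl | hs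
    exacts [.inr h, .inl ⟨s, hs, h⟩]
  · rintro (⟨s, hs, h⟩ | h)
    exacts [⟨s, by omega, h⟩, ⟨t, by omega, h⟩]

open Classical in
/-- The lengths of the slices at those places below `t` that are the last occurrence of their
variable among the first `i` symbols, from the first variable on that is needed later. -/
noncomputable def digits (nx : ℕ → ℕ) (n i : ℕ) (p : ℕ → ℕ) : ℕ → List ℕ
  | 0 => []
  | t + 1 => if i ≤ nx t ∧ Opened nx n i (t + 1) then digits nx n i p t ++ [p (t + 1) - p t]
      else digits nx n i p t

/-- Evaluation of digits in base `m + 1`, with a leading digit `c`. -/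
def horner (m c : ℕ) (l : List ℕ) : ℕ := l.foldl (fun c d => c * (m + 1) + d) c

theorem horner_append (c d : ℕ) (l : List ℕ) :
    horner m c (l ++ [d]) = horner m c l * (m + 1) + d := by
  simp [horner]

theorem horner_lt {c : ℕ} (hc : c ≤ m) {l : List ℕ} (hl : ∀ d ∈ l, d ≤ m) :
    horner m c l < (m + 1) ^ (l.length + 1) := by
  induction l using List.reverseRecOn with
  | nil => simp [horner]; omega
  | append_singleton l d ih =>
    have h1 := ih fun e he => hl e (by simp [he])
    have h2 := hl d (by simp)
    have h3 := Nat.mul_le_mul_right (m + 1) (Nat.succ_le_of_lt h1)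
    rw [horner_append, List.length_append, List.length_singleton, pow_succ _ (l.length + 1)]
    rw [Nat.succ_mul] at h3
    omega

/-- Uniqueness of expansions in base m + 1: the last digit is the remainder. The leading digit is
only ever a quotient, so it needs no bound. -/
theorem horner_inj {c c' : ℕ} {l l' : List ℕ} (hll : l.length = l'.length) (hl : ∀ d ∈ l, d ≤ m)
    (hl' : ∀ d ∈ l', d ≤ m) (h : horner m c l = horner m c' l') : c = c' ∧ l = l' := by
  induction l using List.reverseRecOn generalizing l' with
  | nil =>
    obtain rfl : l' = [] := List.length_eq_zero_iff.1 hll.symm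
    exact ⟨h, rfl⟩
  | append_singleton l d ih =>
    rcases l'.eq_nil_or_concat with rfl | ⟨l', d', rfl⟩
    · simp at hll
    · rw [List.concat_eq_append] at *
      rw [horner_append, horner_append] at h
      have hd := hl d (by simp)
      have hd' := hl' d' (by simp)
      have e1 : horner m c l = horner m c' l' := by
        have := congrArg (· / (m + 1)) h
        simpa [Nat.add_div_of_dvd_right, Nat.div_eq_of_lt (Nat.lt_succ_of_le hd),
          Nat.div_eq_of_lt (Nat.lt_succ_of_le hd')] using this
      obtain ⟨rfl, rfl⟩ := ih (by simpa using hll) (fun e he => hl e (by simp [he]))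
        (fun e he => hl' e (by simp [he])) e1
      rw [e1] at h
      exact ⟨rfl, by simpa using h⟩

/-- Which places contribute a digit depends on the pattern and on `i` alone, so digit lists of
different cuts can be compared entry by entry. -/
theorem length_digits (t : ℕ) :
    (digits nx n i p t).length = (digits nx n i q t).length := by
  induction t with
  | zero => rfl
  | succ t ih => rw [digits, digits]; split <;> simp [ih]

/-- The digits are lengths of disjoint factors between p 0 and p t. -/
theorem sum_digits_le {t : ℕ} (hp : ∀ s < t, p s ≤ p (s + 1)) :
    (digits nx n i p t).sum + p 0 ≤ p t := by
  induction t with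
  | zero => simp [digits]
  | succ t ih =>
    have h1 := ih fun s hs => hp s (by omega)
    have h2 := hp t (by omega)
    rw [digits]
    split
    · rw [List.sum_append, List.sum_singleton]; omega
    · omega

theorem digits_congr {t : ℕ} (h : ∀ s ≤ t, q s = p s) : digits nx n i q t = digits nx n i p t := by
  induction t with
  | zero => rfl
  | succ t ih =>
    rw [digits, digits, ih fun s hs => h s (by omega), h t (by omega), h (t + 1) le_rfl]

theorem eq_of_digits_eq {t s : ℕ} (h : digits nx n i p t = digits nx n i q t) (hs : s < t)
    (h1 : i ≤ nx s) (h2 : Opened nx n i (s + 1)) : p (s + 1) - p s = q (s + 1) - q s := by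
  induction t with
  | zero => omega
  | succ t ih =>
    have hl := length_digits (nx := nx) (n := n) (i := i) (p := p) (q := q) t
    rcases (Nat.lt_succ_iff.1 hs).eq_or_lt with rfl | hs
    · rw [digits, digits, if_pos ⟨h1, h2⟩, if_pos ⟨h1, h2⟩] at h
      simpa using (List.append_inj h hl).2
    · refine ih ?_ hs
      rw [digits, digits] at h
      split at h
      · exact (List.append_inj h hl).1
      · exact h

/-- The number under which the search remembers the cuts `p 0, …, p i`. -/
noncomputable def cutKey (nx : ℕ → ℕ) (n m i : ℕ) (p : ℕ → ℕ) : ℕ :=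
  i + (n + 1) * horner m (p i) (digits nx n i p i)

theorem cutKey_congr (h : ∀ s ≤ i, q s = p s) : cutKey nx n m i q = cutKey nx n m i p := by
  rw [cutKey, cutKey, digits_congr h, h i le_rfl]

/-- The level is the remainder of the key modulo n + 1. -/
theorem level_eq_of_cutKey_eq {j : ℕ} (hi : i ≤ n) (hj : j ≤ n)
    (h : cutKey nx n m i p = cutKey nx n m j q) : i = j := by
  have := congrArg (· % (n + 1)) h
  simpa [cutKey, Nat.mod_eq_of_lt (Nat.lt_succ_of_le hi), Nat.mod_eq_of_lt (Nat.lt_succ_of_le hj)]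
    using this

theorem Consistent.digit_le (h : Consistent A W m i p) : ∀ d ∈ digits nx n i p i, d ≤ m := by
  intro d hd
  have h1 := List.le_sum_of_mem hd
  have h2 := sum_digits_le (nx := nx) (n := n) (i := i) h.mono
  have h3 := h.le i le_rfl
  omega

/-- Below `i`, every variable of the pattern has a last occurrence. -/
theorem exists_last_occurrence (hnx : IsNext A n nx) {s : ℕ} (hs : s < i) (hi : i ≤ n) :
    ∃ t, s ≤ t ∧ t < i ∧ A t = A s ∧ i ≤ nx t := by
  induction h : i - s using Nat.strong_induction_on generalizing s with
  | _ k ih =>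
    obtain ⟨h1, h2, h3, h4⟩ := hnx s (by omega)
    rcases le_or_gt i (nx s) with h5 | h5
    · exact ⟨s, le_rfl, hs, rfl, h5⟩
    · obtain ⟨t, ht1, ht2, ht3, ht4⟩ := ih (i - nx s) (by omega) h5 rfl
      exact ⟨t, by omega, ht2, ht3.trans (h4 (by omega)), ht4⟩

/-- Two cuts with the same key can be continued in the same way. -/
theorem Consistent.exchange (hnx : IsNext A n nx) (hi : i ≤ n) (hp : Consistent A W m i p)
    (hq : Consistent A W m i q) (hkey : cutKey nx n m i p = cutKey nx n m i q) {P : ℕ → ℕ}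
    (hP : Consistent A W m n P) (hPp : ∀ t ≤ i, P t = p t) :
    ∃ Q, Consistent A W m n Q ∧ (∀ t ≤ i, Q t = q t) ∧ Q n = P n := by
  have hh : horner m (p i) (digits nx n i p i) = horner m (q i) (digits nx n i q i) := by
    simpa [cutKey] using hkey
  obtain ⟨hpq, hdig⟩ := horner_inj (length_digits i) hp.digit_le hq.digit_le hh
  -- all slices from an open place on have the same lengths
  have len : ∀ s < i, Opened nx n i (s + 1) → p (s + 1) - p s = q (s + 1) - q s := by
    intro s hs ho
    obtain ⟨t, ht1, ht2, ht3, ht4⟩ := exists_last_occurrence hnx hs hi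
    have ho' : Opened nx n i (t + 1) := by
      obtain ⟨r, hr, h⟩ := ho
      exact ⟨r, by omega, h⟩
    rw [(hp.same s hs t ht2 ht3.symm).1, (hq.same s hs t ht2 ht3.symm).1]
    exact eq_of_digits_eq hdig ht2 ht4 ho'
  -- Equal lengths become equal positions by counting back from the common end p i = q i.
  have pos : ∀ k s, s + k = i → Opened nx n i (s + 1) → p s = q s := by
    intro k
    induction k with
    | zero => intro s hs _; obtain rfl : s = i := by omega
              exact hpq
    | succ k ih =>
      intro s hs ho
      have h1 := ih (s + 1) (by omega) (by obtain ⟨r, hr, h⟩ := ho; exact ⟨r, by omega, h⟩)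
      have h2 := len s (by omega) ho
      have h3 := hp.mono s (by omega)
      have h4 := hq.mono s (by omega)
      omega
  set Q : ℕ → ℕ := fun t => if t ≤ i then q t else P t with hQ
  have hQq : ∀ t ≤ i, Q t = q t := fun t ht => by simp [hQ, ht]
  have hQP : ∀ t, i ≤ t → Q t = P t := by
    intro t ht
    rcases ht.eq_or_lt with rfl | ht
    · rw [hQq _ le_rfl, ← hpq, hPp _ le_rfl]
    · simp [hQ, Nat.not_le.2 ht]
  -- a variable that is needed later has the same image
  have main : ∀ s < i, ∀ t, i ≤ t → t < n → A s = A t → SameSlice W Q s t := by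
    intro s hs t hit htn hst
    obtain ⟨r, hr1, hr2, hr3, hr4⟩ := exists_last_occurrence hnx hs hi
    -- The variable occurs again at `t`, so its last occurrence `r` below `i` is an open place, and
    -- both cuts give it the same factor of the word, not just the same length.
    have hrn : nx r < n := by
      by_contra hcon
      exact (hnx r (by omega)).2.2.1 t (by omega) (by omega) (hst.symm.trans hr3.symm)
    have e1 := pos (i - r) r (by omega) ⟨r, by omega, hr4, hrn⟩
    have e2 := pos (i - (r + 1)) (r + 1) (by omega) ⟨r, by omega, hr4, hrn⟩
    have h1 : SameSlice W Q s r := (hq.same s hs r hr2 hr3.symm).congr (hQq _ (by omega))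
      (hQq _ (by omega)) (hQq _ (by omega)) (hQq _ (by omega))
    refine h1.trans ((hP.same r (by omega) t htn (hr3.trans hst)).congr ?_ ?_ (hQP _ hit)
      (hQP _ (by omega)))
    · rw [hQq r (by omega), ← e1, hPp r (by omega)]
    · rw [hQq (r + 1) (by omega), ← e2, hPp (r + 1) (by omega)]
  refine ⟨Q, ⟨(hQq 0 (by omega)).trans hq.zero, fun t ht => ?_, fun t ht => ?_,
    fun s hs t ht hst => ?_⟩, hQq, hQP n hi⟩
  · rcases lt_or_ge t i with h | h
    · rw [hQq t h.le, hQq _ h]; exact hq.mono t h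
    · rw [hQP t h, hQP _ (by omega)]; exact hP.mono t ht
  · rcases le_or_gt t i with h | h
    · rw [hQq t h]; exact hq.le t h
    · rw [hQP t h.le]; exact hP.le t ht
  · rcases lt_or_ge s i with hsi | hsi <;> rcases lt_or_ge t i with hti | hti
    · exact (hq.same s hsi t hti hst).congr (hQq _ (by omega)) (hQq _ (by omega))
        (hQq _ (by omega)) (hQq _ (by omega))
    · exact main s hsi t hti ht hst
    · exact (main t hti s hsi hs hst.symm).symm
    · exact (hP.same s hs t ht hst).congr (hQP _ hsi) (hQP _ (by omega)) (hQP _ hti)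
        (hQP _ (by omega))

/-! ### Counting keys -/

/-- At most `k` different variables stand between consecutive occurrences of a variable. -/
def SeparatedBy (A : ℕ → ℕ) (n k : ℕ) : Prop :=
  ∀ s u, s < u → u < n → A s = A u → (∀ v, s < v → v < u → A v ≠ A s) →
    ((Finset.Ioo s u).image A).card ≤ k

open Classical in
theorem length_digits_eq_card (t : ℕ) : (digits nx n i p t).length =
    ((Finset.range t).filter fun s => i ≤ nx s ∧ Opened nx n i (s + 1)).card := by
  induction t with
  | zero => rfl
  | succ t ih =>
    rw [digits, Finset.range_add_one, Finset.filter_insert]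
    split
    · rw [Finset.card_insert_of_notMem (by simp), ← ih]; simp
    · exact ih

/-- Let `j` be the first place whose variable is still needed. All other places with a digit lie
strictly between `j` and `nx j`, and being last occurrences they carry different variables; so there
are at most k of them, and `j` adds one. -/
theorem length_digits_le {k : ℕ} (hnx : IsNext A n nx) (hk : SeparatedBy A n k) (_hi : i ≤ n)
    {t : ℕ} (ht : t ≤ i) : (digits nx n i p t).length ≤ k + 1 := by
  classical
  rw [length_digits_eq_card]
  set D := (Finset.range t).filter fun s => i ≤ nx s ∧ Opened nx n i (s + 1) with hD
  by_cases hne : ∃ j, i ≤ nx j ∧ nx j < n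
  · set j := Nat.find hne with hj
    obtain ⟨hj1, hj2⟩ : i ≤ nx j ∧ nx j < n := Nat.find_spec hne
    have hmin : ∀ s, i ≤ nx s → nx s < n → j ≤ s := fun s h h' => Nat.find_min' hne ⟨h, h'⟩
    have hle : ∀ s ∈ D, j ≤ s ∧ s < t ∧ i ≤ nx s := by
      intro s hs
      rw [hD, Finset.mem_filter, Finset.mem_range] at hs
      obtain ⟨hs1, hs2, r, hr, hr1, hr2⟩ := hs
      have := hmin r hr1 hr2
      omega
    by_cases hjt : j < t
    · have hnj := hnx j (by omega)
      have h1 : (D.erase j).card ≤ ((Finset.Ioo j (nx j)).image A).card := by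
        refine Finset.card_le_card_of_injOn A ?_ ?_
        · intro s hs
          rw [Finset.mem_coe, Finset.mem_erase] at hs
          have := hle s hs.2
          refine Finset.mem_coe.2 (Finset.mem_image_of_mem _ (Finset.mem_Ioo.2 ?_))
          omega
        · have aux : ∀ s ∈ D, ∀ r ∈ D, s < r → A s ≠ A r := by
            intro s hs r hr hsr h
            have h1 := hle s hs
            have h2 := hle r hr
            exact (hnx s (by omega)).2.2.1 r hsr (by omega) h.symm
          intro s hs r hr h
          rw [Finset.mem_coe, Finset.mem_erase] at hs hr
          by_contra hne'
          rcases lt_or_gt_of_ne hne' with h' | h'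
          · exact aux s hs.2 r hr.2 h' h
          · exact aux r hr.2 s hs.2 h' h.symm
      have h2 := hk j (nx j) hnj.1 hj2 (hnj.2.2.2 hj2).symm hnj.2.2.1
      have h3 := Finset.pred_card_le_card_erase (s := D) (a := j)
      omega
    · have : D = ∅ := Finset.eq_empty_of_forall_notMem fun s hs => by have := hle s hs; omega
      simp [this]
  · have : D = ∅ := Finset.eq_empty_of_forall_notMem fun s hs => by
      rw [hD, Finset.mem_filter] at hs
      obtain ⟨-, -, r, -, hr⟩ := hs
      exact hne ⟨r, hr⟩
    simp [this]

/-- All lists of length `r` with sum at most `m`. -/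
def boundedLists : ℕ → ℕ → Finset (List ℕ)
  | 0, _ => {[]}
  | r + 1, 0 => (boundedLists r 0).image (List.cons 0)
  | r + 1, m + 1 => (boundedLists r (m + 1)).image (List.cons 0) ∪
      (boundedLists (r + 1) m).image fun l => (l.headD 0 + 1) :: l.tail

theorem mem_boundedLists (l : List ℕ) : ∀ m, l.sum ≤ m → l ∈ boundedLists l.length m := by
  induction l with
  | nil => intro m _; simp [boundedLists]
  | cons d l ih =>
    induction d with
    | zero =>
      intro m hm
      have := ih m (by simpa using hm)
      cases m with
      | zero => simp only [List.length_cons, boundedLists]; exact Finset.mem_image_of_mem _ this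
      | succ m =>
        simp only [List.length_cons, boundedLists]
        exact Finset.mem_union_left _ (Finset.mem_image_of_mem _ this)
    | succ d ihd =>
      intro m hm
      rw [List.sum_cons] at hm
      obtain ⟨m, rfl⟩ : ∃ m', m = m' + 1 := ⟨m - 1, by omega⟩
      have := ihd m (by rw [List.sum_cons]; omega)
      simp only [List.length_cons, boundedLists] at this ⊢
      exact Finset.mem_union_right _ (Finset.mem_image.2 ⟨_, this, by simp⟩)

/-- The recursion is Pascal's rule: the head is zero, or it can be lowered by one together with the
bound on the sum. -/
theorem card_boundedLists_le (r m : ℕ) : (boundedLists r m).card ≤ (m + r).choose r := by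
  induction r, m using boundedLists.induct with
  | case1 m => simp [boundedLists]
  | case2 r ih =>
    rw [boundedLists]
    refine Finset.card_image_le.trans (ih.trans ?_)
    simp
  | case3 r m ih1 ih2 =>
    rw [boundedLists]
    refine (Finset.card_union_le _ _).trans
      ((Nat.add_le_add (Finset.card_image_le.trans ih1) (Finset.card_image_le.trans ih2)).trans ?_)
    rw [show m + 1 + (r + 1) = (m + 1 + r) + 1 by ring, Nat.choose_succ_succ,
      show m + (r + 1) = m + 1 + r by ring]

/-- A set that contains all keys. -/
noncomputable def keySet (nx : ℕ → ℕ) (n m : ℕ) : Finset ℕ :=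
  (Finset.Icc 1 n).biUnion fun i =>
    (Finset.range (m + 1) ×ˢ boundedLists (digits nx n i id i).length m).image
      fun x => i + (n + 1) * horner m x.1 x.2

theorem Consistent.cutKey_mem (h : Consistent A W m i p) (hi : 1 ≤ i) (hin : i ≤ n) :
    cutKey nx n m i p ∈ keySet nx n m := by
  have h1 := sum_digits_le (nx := nx) (n := n) (i := i) h.mono
  have h2 := h.le i le_rfl
  refine Finset.mem_biUnion.2 ⟨i, Finset.mem_Icc.2 ⟨hi, hin⟩,
    Finset.mem_image.2 ⟨(p i, digits nx n i p i), ?_, rfl⟩⟩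
  rw [Finset.mem_product, length_digits (p := id) (q := p)]
  exact ⟨Finset.mem_range.2 (by simpa using Nat.lt_succ_of_le h2),
    mem_boundedLists _ _ (by omega)⟩

theorem card_keySet_le {k : ℕ} (hnx : IsNext A n nx) (hk : SeparatedBy A n k) :
    (keySet nx n m).card ≤ n * ((m + 1) * (m + (k + 1)).choose (k + 1)) := by
  refine (Finset.card_biUnion_le_card_mul _ _ ((m + 1) * (m + (k + 1)).choose (k + 1))
    fun i hi => ?_).trans_eq (by rw [Nat.card_Icc, Nat.add_sub_cancel])
  have hi := (Finset.mem_Icc.1 hi).2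
  refine Finset.card_image_le.trans ?_
  rw [Finset.card_product, Finset.card_range]
  refine Nat.mul_le_mul_left _ ((card_boundedLists_le _ _).trans ?_)
  have h := length_digits_le (p := id) hnx hk hi le_rfl
  -- With the lower index turned into m, the coefficient is monotone in the number of digits.
  rw [← Nat.choose_symm_add, ← Nat.choose_symm_add]
  exact Nat.choose_le_choose _ (by omega)

/-- Raising k by one multiplies the coefficient by (m + k + 2) / (k + 2), which is at most m because
m ≥ 2. -/
theorem choose_le_two_mul_pow (hm : 2 ≤ m) (k : ℕ) :
    (m + (k + 1)).choose (k + 1) ≤ 2 * m ^ (k + 1) := by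
  induction k with
  | zero => simp; omega
  | succ k ih =>
    have h1 := Nat.add_one_mul_choose_eq (m + (k + 1)) (k + 1)
    have h2 : m + (k + 1) + 1 ≤ m * (k + 2) := by nlinarith
    refine Nat.le_of_mul_le_mul_right (c := k + 1 + 1) ?_ (by omega)
    rw [show m + (k + 1 + 1) = m + (k + 1) + 1 by ring, ← h1]
    calc (m + (k + 1) + 1) * (m + (k + 1)).choose (k + 1)
        ≤ (m * (k + 2)) * (2 * m ^ (k + 1)) := Nat.mul_le_mul h2 ih
      _ = 2 * m ^ (k + 1 + 1) * (k + 1 + 1) := by ring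

/-- The product is keys times rounds per key times cost per round. For m ≤ 1 the power of `max 1 m`
is 1 and contributes nothing; there the coefficient is at most k + 2, and k ≤ n turns this into the
third factor n. -/
theorem card_keySet_le_pow {k : ℕ} (hnx : IsNext A n nx) (hk : SeparatedBy A n k) (hkn : k ≤ n)
    (hn : 1 ≤ n) : ((keySet nx n m).card + 1) * ((m + 3) * ((n + 1) * (m + 1))) ≤
      200 * n ^ 3 * (max 1 m) ^ (k + 4) := by
  have h := card_keySet_le (m := m) hnx hk
  rcases Nat.lt_or_ge m 2 with hm | hm
  · have h1 : max 1 m = 1 := by omega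
    have h2 : (m + (k + 1)).choose (k + 1) ≤ k + 2 := by
      interval_cases m
      · simp
      · rw [Nat.add_comm, Nat.choose_succ_self_right]
    have h3 : (keySet nx n m).card ≤ 6 * n ^ 2 := by
      refine h.trans ((Nat.mul_le_mul_left n (Nat.mul_le_mul (show m + 1 ≤ 2 by omega)
        (h2.trans (show k + 2 ≤ 3 * n by omega)))).trans_eq ?_)
      ring
    have h4 : 1 ≤ n ^ 2 := Nat.one_le_pow _ _ hn
    rw [h1, one_pow, mul_one]
    calc _ ≤ (7 * n ^ 2) * (4 * ((2 * n) * 2)) := by gcongr <;> omega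
      _ = 112 * n ^ 3 := by ring
      _ ≤ _ := by omega
  · have h1 : max 1 m = m := by omega
    have h2 : (keySet nx n m).card ≤ 4 * n * m ^ (k + 2) := by
      refine h.trans ((Nat.mul_le_mul_left n (Nat.mul_le_mul (show m + 1 ≤ 2 * m by omega)
        (choose_le_two_mul_pow hm k))).trans_eq ?_)
      ring
    have h3 : 1 ≤ n * m ^ (k + 2) := Nat.mul_pos hn (Nat.pow_pos (by omega))
    have h4 : n ^ 2 ≤ n ^ 3 := Nat.pow_le_pow_right hn (by omega)
    rw [h1]
    calc _ ≤ (5 * (n * m ^ (k + 2))) * ((3 * m) * ((2 * n) * (2 * m))) := by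
          gcongr <;> first | omega | (rw [mul_assoc] at h2; omega)
      _ = 60 * n ^ 2 * m ^ (k + 4) := by ring
      _ ≤ 200 * n ^ 3 * m ^ (k + 4) := by gcongr; omega

end Cuts

/-! ### The search

The search runs through the cuts `p 0, …, p i` in lexicographic order and remembers in `V` the keys
of the consistent ones that it has extended. -/

/-- Cuts of the whole word of length `m` along the whole pattern of length `n`. -/
structure IsSolution (A W : ℕ → ℕ) (n m : ℕ) (P : ℕ → ℕ) : Prop where
  consistent : Consistent A W m n P
  last : P n = m

/-- Only the cuts below level `i` have been tested; p i is the candidate under examination, and its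
value m + 1 means that the level is exhausted. -/
structure SearchInv (A W nx : ℕ → ℕ) (n m i : ℕ) (p : ℕ → ℕ) (V : Finset ℕ) : Prop where
  pos : 1 ≤ i
  le : i ≤ n
  consistent : Consistent A W m (i - 1) p
  mono : p (i - 1) ≤ p i
  bound : p i ≤ m + 1
  /-- no solution comes before `p` -/
  least : ∀ j, 1 ≤ j → j ≤ i → ∀ P, IsSolution A W n m P → (∀ l < j, P l = p l) → p j ≤ P j
  /-- cuts with a known key cannot be continued, unless they are the present ones -/
  dead : ∀ j Q, 1 ≤ j → j ≤ n → Consistent A W m j Q → cutKey nx n m j Q ∈ V →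
    (∀ P, IsSolution A W n m P → ¬ ∀ l ≤ j, P l = Q l) ∨
      j < i ∧ cutKey nx n m j Q = cutKey nx n m j p
  subset : V ⊆ keySet nx n m

/-- Every key not yet known is worth m + 3, and every level on the stack is worth the values still
to be tried there. Extending the cuts trades a key for a new level worth at most m + 2. -/
noncomputable def searchMeasure (nx : ℕ → ℕ) (n m i : ℕ) (p : ℕ → ℕ) (V : Finset ℕ) : ℕ :=
  ((keySet nx n m).card - V.card) * (m + 3) + ∑ j ∈ Finset.Icc 1 i, (m + 2 - p j)

section Search

variable {A W nx : ℕ → ℕ} {n m i : ℕ} {p : ℕ → ℕ} {V : Finset ℕ}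

theorem sum_measure_succ (i : ℕ) (p : ℕ → ℕ) : ∑ j ∈ Finset.Icc 1 (i + 1), (m + 2 - p j) =
    ∑ j ∈ Finset.Icc 1 i, (m + 2 - p j) + (m + 2 - p (i + 1)) :=
  Finset.sum_Icc_succ_top (by omega) _

theorem sum_measure_congr {q : ℕ → ℕ} (h : ∀ j ≤ i, q j = p j) :
    ∑ j ∈ Finset.Icc 1 i, (m + 2 - q j) = ∑ j ∈ Finset.Icc 1 i, (m + 2 - p j) :=
  Finset.sum_congr rfl fun j hj => by rw [h j (Finset.mem_Icc.1 hj).2]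

theorem searchInv_init (hn : 1 ≤ n) (h0 : p 0 = 0) (h1 : p 1 = 0) :
    SearchInv A W nx n m 1 p ∅ where
  pos := le_rfl
  le := hn
  consistent := ⟨h0, by omega, fun t ht => by obtain rfl : t = 0 := by omega
                                              omega, by omega⟩
  mono := by simp [h0]
  bound := by omega
  least j hj hj' P _ _ := by obtain rfl : j = 1 := by omega
                             omega
  dead := by simp
  subset := by simp

theorem searchMeasure_init (h1 : p 1 = 0) :
    searchMeasure nx n m 1 p ∅ = (keySet nx n m).card * (m + 3) + (m + 2) := by
  simp [searchMeasure, h1]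

namespace SearchInv

/-- Go on to the next value of `p i`. -/
theorem skip (h : SearchInv A W nx n m i p V) (hp : p i ≤ m)
    (hdead : ∀ P, IsSolution A W n m P → ¬ ∀ l ≤ i, P l = p l) :
    SearchInv A W nx n m i (Function.update p i (p i + 1)) V ∧
      searchMeasure nx n m i (Function.update p i (p i + 1)) V < searchMeasure nx n m i p V := by
  have hi := h.pos
  set q := Function.update p i (p i + 1) with hq
  have q1 : ∀ j < i, q j = p j := fun j hj => Function.update_of_ne (by omega) _ _
  have q2 : q i = p i + 1 := Function.update_self ..
  refine ⟨⟨hi, h.le, h.consistent.congr fun t ht => q1 t (by omega), ?_, by omega, ?_, ?_,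
    h.subset⟩, ?_⟩
  · rw [q1 _ (by omega), q2]; exact h.mono.trans (Nat.le_succ _)
  · intro j hj hji P hP hPj
    rcases hji.eq_or_lt with rfl | hji
    · have hPp : ∀ l < j, P l = p l := fun l hl => (hPj l hl).trans (q1 l hl)
      have := h.least j hj le_rfl P hP hPp
      rw [q2]
      refine Nat.succ_le_of_lt (lt_of_le_of_ne this fun heq => hdead P hP fun l hl => ?_)
      rcases hl.eq_or_lt with rfl | hl
      exacts [heq.symm, hPp l hl]
    · rw [q1 j hji]
      exact h.least j hj hji.le P hP fun l hl => (hPj l hl).trans (q1 l (by omega))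
  · intro j Q hj hjn hQ hV
    refine (h.dead j Q hj hjn hQ hV).imp_right fun h' => ⟨h'.1, h'.2.trans ?_⟩
    exact (cutKey_congr fun s hs => q1 s (by omega)).symm
  · obtain ⟨i, rfl⟩ : ∃ j, i = j + 1 := ⟨i - 1, by omega⟩
    rw [searchMeasure, searchMeasure, sum_measure_succ, sum_measure_succ,
      sum_measure_congr fun j hj => q1 j (by omega), q2]
    omega

/-- All values of `p i` have been tried. -/
theorem pop (hnx : IsNext A n nx) (h : SearchInv A W nx n m i p V) (hp : m < p i) (hi : 2 ≤ i) :
    SearchInv A W nx n m (i - 1) (Function.update p (i - 1) (p (i - 1) + 1)) V ∧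
      searchMeasure nx n m (i - 1) (Function.update p (i - 1) (p (i - 1) + 1)) V <
        searchMeasure nx n m i p V := by
  have hin := h.le
  -- A solution continuing p 0, …, p (i - 1) would have its next cut at p i or later, hence beyond
  -- m.
  have hdead : ∀ P, IsSolution A W n m P → ¬ ∀ l ≤ i - 1, P l = p l := by
    intro P hP hPp
    have h1 := h.least i (by omega) le_rfl P hP fun l hl => hPp l (by omega)
    have h2 := hP.consistent.le i h.le
    omega
  have h' : SearchInv A W nx n m (i - 1) p V := by
    refine ⟨by omega, by omega, h.consistent.of_le (by omega), ?_, ?_,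
      fun j hj hji => h.least j hj (by omega), ?_, h.subset⟩
    · have := h.consistent.mono (i - 1 - 1) (by omega)
      rwa [Nat.sub_add_cancel (by omega)] at this
    · exact (h.consistent.le (i - 1) le_rfl).trans (Nat.le_succ _)
    · intro j Q hj hjn hQ hV
      rcases h.dead j Q hj hjn hQ hV with h1 | ⟨h1, h2⟩
      · exact .inl h1
      · rcases (show j ≤ i - 1 by omega).eq_or_lt with rfl | h3
        -- The key of the level being left loses its exemption. It is now dead for all cuts that
        -- share it: by exchange, a continuation of `Q` would give one of `p`.
        · refine .inl fun P hP hPQ => ?_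
          obtain ⟨R, hR, hRp, hRn⟩ := hQ.exchange hnx hjn h.consistent h2 hP.consistent hPQ
          exact hdead R ⟨hR, hRn.trans hP.last⟩ hRp
        · exact .inr ⟨h3, h2⟩
  obtain ⟨h1, h2⟩ := h'.skip (h.consistent.le (i - 1) le_rfl) hdead
  refine ⟨h1, h2.trans_le ?_⟩
  obtain ⟨i, rfl⟩ : ∃ j, i = j + 1 := ⟨i - 1, by omega⟩
  rw [searchMeasure, searchMeasure, sum_measure_succ, Nat.add_sub_cancel]
  omega

theorem not_isSolution (h : SearchInv A W nx n m 1 p V) (hp : m < p 1) (P : ℕ → ℕ) :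
    ¬ IsSolution A W n m P := by
  intro hP
  have h1 := h.least 1 le_rfl le_rfl P hP fun l hl => by
    obtain rfl : l = 0 := by omega
    rw [hP.consistent.zero, h.consistent.zero]
  have h2 := hP.consistent.le 1 h.le
  omega

/-- This covers both reasons for rejecting a candidate, inconsistency and a known key. The exemption
for present cuts concerns levels strictly below `i`, so it does not apply. -/
theorem not_extendable (h : SearchInv A W nx n m i p V)
    (hV : Consistent A W m i p → cutKey nx n m i p ∈ V) :
    ∀ P, IsSolution A W n m P → ¬ ∀ l ≤ i, P l = p l := by
  intro P hP hPp
  have hc : Consistent A W m i p :=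
    (hP.consistent.of_le h.le).congr fun t ht => (hPp t ht).symm
  rcases h.dead i p h.pos h.le hc (hV hc) with h1 | h1
  · exact h1 P hP hPp
  · omega

/-- Remember the present cuts and extend them. -/
theorem push (h : SearchInv A W nx n m i p V) (hc : Consistent A W m i p)
    (hV : cutKey nx n m i p ∉ V) (hi : i < n) :
    SearchInv A W nx n m (i + 1) (Function.update p (i + 1) (p i)) (insert (cutKey nx n m i p) V) ∧
      searchMeasure nx n m (i + 1) (Function.update p (i + 1) (p i))
        (insert (cutKey nx n m i p) V) < searchMeasure nx n m i p V := by
  have hpos := h.pos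
  have hpm := hc.le i le_rfl
  set q := Function.update p (i + 1) (p i) with hq
  have q1 : ∀ j ≤ i, q j = p j := fun j hj => Function.update_of_ne (by omega) _ _
  have q2 : q (i + 1) = p i := Function.update_self ..
  have hsub : insert (cutKey nx n m i p) V ⊆ keySet nx n m :=
    Finset.insert_subset (hc.cutKey_mem h.pos h.le) h.subset
  refine ⟨⟨by omega, hi, hc.congr q1, ?_, by omega, ?_, ?_, hsub⟩, ?_⟩
  · rw [Nat.add_sub_cancel, q1 i le_rfl, q2]
  · intro j hj hji P hP hPj
    rcases hji.eq_or_lt with rfl | hji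
    · rw [q2, ← q1 i le_rfl, ← hPj i (by omega)]
      exact hP.consistent.mono i hi
    · rw [q1 j (by omega)]
      exact h.least j hj (by omega) P hP fun l hl => (hPj l hl).trans (q1 l (by omega))
  · intro j Q hj hjn hQ hQV
    rcases Finset.mem_insert.1 hQV with h1 | h1
    -- The new key can only belong to level `i`, which now lies below the current level and is
    -- therefore exempt.
    · obtain rfl := level_eq_of_cutKey_eq hjn h.le h1
      exact .inr ⟨by omega, h1.trans (cutKey_congr q1).symm⟩
    · refine (h.dead j Q hj hjn hQ h1).imp_right fun h' => ⟨by omega, h'.2.trans ?_⟩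
      exact (cutKey_congr fun s hs => q1 s (by omega)).symm
  · have h1 := Finset.card_le_card hsub
    rw [Finset.card_insert_of_notMem hV] at h1
    rw [searchMeasure, searchMeasure, sum_measure_succ, sum_measure_congr q1, q2,
      Finset.card_insert_of_notMem hV]
    obtain ⟨d, hd⟩ := Nat.exists_eq_add_of_le h1
    rw [hd, Nat.add_sub_cancel_left, show V.card + 1 + d - V.card = d + 1 by omega, Nat.succ_mul]
    omega

end SearchInv

end Search

/-! ### Memory layout and program of the search -/

namespace RAM

attribute [simp] Expr.eval Expr.Safe Expr.size

/-- The stores differ at most in the variables of `L`. -/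
def Store.AgreeOff (s s' : Store) (L : List Var) : Prop :=
  s'.mem = s.mem ∧ ∀ v, v ∉ L → s'.reg v = s.reg v

theorem Store.AgreeOff.refl (s : Store) (L : List Var) : s.AgreeOff s L := ⟨rfl, fun _ _ => rfl⟩

theorem Store.AgreeOff.set {s s' : Store} {L : List Var} (h : s.AgreeOff s' L) {v : Var}
    (hv : v ∈ L) (x : ℕ) : s.AgreeOff (s'.set v x) L :=
  ⟨h.1, fun u hu => by
    rw [Store.set_reg, if_neg (by rintro rfl; exact hu hv)]; exact h.2 u hu⟩

theorem Store.AgreeOff.trans {s s' s'' : Store} {L L' : List Var} (h : s.AgreeOff s' L)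
    (h' : s'.AgreeOff s'' L') (hL : L' ⊆ L) : s.AgreeOff s'' L :=
  ⟨h'.1.trans h.1, fun v hv => (h'.2 v fun hv' => hv (hL hv')).trans (h.2 v hv)⟩

/-- Register and memory contents during the search: the lengths of pattern and word, the pattern,
the word, the next occurrences, the cuts, and the table of known keys. -/
structure Layout (A W nx : ℕ → ℕ) (n m : ℕ) (p : ℕ → ℕ) (V : Finset ℕ) (s : Store) : Prop where
  patLen : s.reg .patLen = n
  wordLen : s.reg .wordLen = m
  pattern : ∀ t < n, s.mem t = A t
  word : ∀ b < m, s.mem (n + b) = W b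
  next : ∀ t < n, s.mem (n + m + t) = nx t
  cuts : ∀ j ≤ n, s.mem (n + n + m + j) = p j
  seen : ∀ a, s.mem (n + n + n + m + 1 + a) = if a ∈ V then 1 else 0

theorem Layout.of_agreeOff {A W nx : ℕ → ℕ} {n m : ℕ} {p : ℕ → ℕ} {V : Finset ℕ} {s s' : Store}
    {L : List Var} (h : Layout A W nx n m p V s) (hs : s.AgreeOff s' L) (h1 : Var.patLen ∉ L)
    (h2 : Var.wordLen ∉ L) : Layout A W nx n m p V s' :=
  ⟨(hs.2 _ h1).trans h.patLen, (hs.2 _ h2).trans h.wordLen, by rw [hs.1]; exact h.pattern,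
    by rw [hs.1]; exact h.word, by rw [hs.1]; exact h.next, by rw [hs.1]; exact h.cuts,
    by rw [hs.1]; exact h.seen⟩

namespace Search

@[simp] def nextAddr (e : Expr) : Expr := .add (.add (.var .patLen) (.var .wordLen)) e

@[simp] def cutAddr (e : Expr) : Expr :=
  .add (.add (.add (.var .patLen) (.var .patLen)) (.var .wordLen)) e

@[simp] def seenAddr (e : Expr) : Expr :=
  .add (.add (.add (.add (.add (.var .patLen) (.var .patLen)) (.var .patLen)) (.var .wordLen))
    (.const 1)) e

@[simp] def incr (v : Var) : Cmd := .assign v (.add (.var v) (.const 1))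

@[simp] def decr (v : Var) : Cmd := .assign v (.sub (.var v) (.const 1))

/-- `acc := acc + cnt * code` -/
def mulAdd : Cmd :=
  .loop (.var .cnt) (.seq (.assign .acc (.add (.var .acc) (.var .code))) (decr .cnt))

/-- Find the first occurrence of the variable before the cut number `lvl`. -/
def findFirst : Cmd :=
  .seq (.assign .fst (.const 0))
    (.loop (.dist (.load (.var .fst)) (.load (.sub (.var .lvl) (.const 1)))) (incr .fst))

/-- Compare the slices at `fst` and at `lvl - 1`. -/
def compareSlices : Cmd :=
  .seq (.assign .prev (.load (cutAddr (.sub (.var .lvl) (.const 1)))))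
    (.seq (.assign .ref (.load (cutAddr (.var .fst))))
      (.seq (.assign .cnt (.sub (.var .cur) (.var .prev)))
        (.ite (.dist (.sub (.load (cutAddr (.add (.var .fst) (.const 1)))) (.var .ref)) (.var .cnt))
          (.assign .bad (.const 1))
          (.seq (.assign .bad (.const 0))
            (.loop (.var .cnt)
              (.seq (decr .cnt)
                (.ite (.dist (.load (.add (.var .patLen) (.add (.var .ref) (.var .cnt))))
                    (.load (.add (.var .patLen) (.add (.var .prev) (.var .cnt)))))
                  -- The language has no empty command; assigning a variable to itself takes its
                  -- place.
                  (.assign .bad (.const 1)) (.assign .bad (.var .bad)))))))))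

/-- Append a digit to `code` if the place `ptr` has one. -/
def addDigit : Cmd :=
  .seq (.assign .nxt (.load (nextAddr (.var .ptr))))
    (.ite (.sub (.var .lvl) (.var .nxt)) (.assign .nxt (.var .nxt))
      -- The flag is updated before the digit is appended, since an open place itself carries the
      -- first digit.
      (.seq (.ite (.sub (.var .patLen) (.var .nxt)) (.assign .flag (.const 1))
          (.assign .nxt (.var .nxt)))
        (.ite (.var .flag)
          (.seq (.assign .acc (.sub (.load (cutAddr (.add (.var .ptr) (.const 1))))
              (.load (cutAddr (.var .ptr)))))
            (.seq (.assign .cnt (.add (.var .wordLen) (.const 1)))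
              (.seq mulAdd (.assign .code (.var .acc)))))
          (.assign .nxt (.var .nxt)))))

/-- Compute the key of the present cuts in `acc`. -/
def computeKey : Cmd :=
  .seq (.assign .code (.var .cur))
    (.seq (.assign .flag (.const 0))
      (.seq (.assign .ptr (.const 0))
        (.seq (.loop (.sub (.var .lvl) (.var .ptr)) (.seq addDigit (incr .ptr)))
          (.seq (.assign .acc (.var .lvl))
            (.seq (.assign .cnt (.add (.var .patLen) (.const 1))) mulAdd)))))

/-- Go on to the next value of the cut number `lvl`. -/
def advance : Cmd :=
  .store (cutAddr (.var .lvl)) (.add (.load (cutAddr (.var .lvl))) (.const 1))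

/-- One round of the search. -/
def searchStep : Cmd :=
  .seq (.assign .cur (.load (cutAddr (.var .lvl))))
    -- From level 1 the decrement leads to level 0, which ends the main loop; the write to cut
    -- number 0 is then harmless, as the cuts are not read again.
    (.ite (.sub (.var .cur) (.var .wordLen)) (.seq (decr .lvl) advance)
      (.seq findFirst (.seq compareSlices (.seq computeKey
        -- The value is nonzero exactly if the cuts are consistent and their key is new.
        (.ite (.sub (.sub (.const 1) (.var .bad)) (.load (seenAddr (.var .acc))))
          (.ite (.sub (.var .patLen) (.var .lvl))
            (.seq (.store (seenAddr (.var .acc)) (.const 1))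
              (.seq (incr .lvl) (.store (cutAddr (.var .lvl)) (.var .cur))))
            (.ite (.dist (.var .cur) (.var .wordLen)) advance
              (.seq (.assign .ans (.const 1)) (.assign .lvl (.const 0)))))
          advance)))))

/-- Tabulate the next occurrences. -/
def tabulateNext : Cmd :=
  .seq (.assign .ptr (.const 0))
    (.loop (.sub (.var .patLen) (.var .ptr))
      (.seq (.assign .nxt (.add (.var .ptr) (.const 1)))
        -- The condition has the form x - (x - y) = min x y and expresses a conjunction: `nxt` is
        -- inside the pattern and its variable differs from the one at `ptr`.
        (.seq (.loop (.sub (.sub (.var .patLen) (.var .nxt)) (.sub (.sub (.var .patLen) (.var .nxt))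
            (.dist (.load (.var .nxt)) (.load (.var .ptr))))) (incr .nxt))
          (.seq (.store (nextAddr (.var .ptr)) (.var .nxt)) (incr .ptr)))))

/-- Decide membership of the word in the pattern language. -/
def matchTest : Cmd :=
  .seq tabulateNext (.seq (.assign .lvl (.const 1)) (.seq (.assign .ans (.const 0))
    -- The answer goes to `patLen` because that variable lives in register 0, the output register.
    (.seq (.loop (.var .lvl) searchStep) (.assign .patLen (.var .ans)))))

/-! ### Correctness and running time of the program -/

variable {A W nx : ℕ → ℕ} {n m : ℕ} {p : ℕ → ℕ} {V : Finset ℕ} {s : Store} {B : ℕ}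

theorem triple_mulAdd (hB : s.reg .acc + s.reg .cnt * s.reg .code ≤ B) (hB1 : 1 ≤ B) :
    Triple B mulAdd s (s.reg .cnt * 11 + 2) fun s' => s.AgreeOff s' [.acc, .cnt] ∧
      s'.reg .acc = s.reg .acc + s.reg .cnt * s.reg .code := by
  refine Triple.loop (T' := 8) (k := s.reg .cnt) (fun k s' => s.AgreeOff s' [.acc, .cnt] ∧
    s'.reg .cnt = k ∧ s'.reg .acc + k * s.reg .code = s.reg .acc + s.reg .cnt * s.reg .code)
    ?_ ?_ ⟨.refl _ _, rfl, rfl⟩ le_rfl ?_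
  · intros; trivial
  · rintro k s' ⟨h1, rfl, h3⟩ h4
    have h4 : s'.reg .cnt ≠ 0 := h4
    have hc : s'.reg .code = s.reg .code := h1.2 _ (by decide)
    obtain ⟨k, hk⟩ := Nat.exists_eq_succ_of_ne_zero h4
    rw [hk, Nat.succ_mul] at h3
    refine Triple.assign_seq ?_ (by simp) (Triple.assign ?_ (by simp) ?_)
    · simp only [Expr.Safe, Expr.eval, true_and]; omega
    · simpa using hB1
    · refine ⟨k, by omega, (h1.set (by decide) _).set (by decide) _, by simp [hk], ?_⟩
      simp
      omega
  · rintro k s' ⟨h1, rfl, h3⟩ h4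
    have h4 : s'.reg .cnt = 0 := h4
    rw [h4, Nat.zero_mul] at h3
    exact ⟨h1, h3⟩

theorem triple_findFirst {i : ℕ} (hs : Layout A W nx n m p V s) (hi : s.reg .lvl = i)
    (h1 : 1 ≤ i) (hin : i ≤ n) (hB : n + 1 ≤ B) :
    Triple B findFirst s (n * 15 + 12) fun s' => s.AgreeOff s' [.fst] ∧
      s'.reg .fst ≤ i - 1 ∧ A (s'.reg .fst) = A (i - 1) ∧ ∀ g < s'.reg .fst, A g ≠ A (i - 1) := by
  refine Triple.assign_seq (by simp) (by simp) ?_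
  have val : ∀ k s', (s.AgreeOff s' [.fst] ∧ s'.reg .fst + k = i - 1 ∧
      ∀ g < s'.reg .fst, A g ≠ A (i - 1)) →
      s'.mem (s'.reg .fst) = A (s'.reg .fst) ∧ s'.mem (s'.reg .lvl - 1) = A (i - 1) := by
    rintro k s' ⟨h2, h3, h4⟩
    have hs' := hs.of_agreeOff h2 (by decide) (by decide)
    rw [hs'.pattern _ (by omega), h2.2 .lvl (by decide), hi, hs'.pattern _ (by omega)]
    exact ⟨rfl, rfl⟩
  refine Triple.loop (T' := 4) (k := i - 1) (fun k s' => s.AgreeOff s' [.fst] ∧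
    s'.reg .fst + k = i - 1 ∧ ∀ g < s'.reg .fst, A g ≠ A (i - 1)) ?_ ?_ ?_ ?_ ?_
  · intros; simp; omega
  · intro k s' hI h0
    obtain ⟨e1, e2⟩ := val k s' hI
    obtain ⟨h2, h3, h4⟩ := hI
    simp only [Expr.eval, e1, e2] at h0
    have hne : A (s'.reg .fst) ≠ A (i - 1) := by omega
    -- The scan stops at place i - 1 at the latest, where the variable is compared with itself.
    have hk : k ≠ 0 := by rintro rfl; exact hne (by rw [← h3, Nat.add_zero])
    refine Triple.assign (by simp; omega) (by simp) ⟨k - 1, by omega, h2.set (by decide) _, ?_, ?_⟩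
    · simp; omega
    · simp only [Store.set_reg, if_true, Expr.eval]
      intro g hg
      rcases (Nat.lt_succ_iff.1 hg).eq_or_lt with rfl | hg
      exacts [hne, h4 g hg]
  · exact ⟨(Store.AgreeOff.refl _ _).set (by decide) _, by simp, by simp⟩
  · simp; omega
  · intro k s' hI h0
    obtain ⟨e1, e2⟩ := val k s' hI
    obtain ⟨h2, h3, h4⟩ := hI
    simp only [Expr.eval, e1, e2] at h0
    exact ⟨h2, by omega, by omega, h4⟩

theorem triple_compareSlices {i : ℕ} (hs : Layout A W nx n m p V s) (hi : s.reg .lvl = i)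
    (h1 : 1 ≤ i) (hin : i ≤ n) (hcur : s.reg .cur = p i) (hmono : ∀ t < i, p t ≤ p (t + 1))
    (hm : ∀ t ≤ i, p t ≤ m) (hf : s.reg .fst < i) (hB : 3 * n + 2 * m + 2 ≤ B) :
    Triple B compareSlices s (m * 28 + 70) fun s' =>
      s.AgreeOff s' [.prev, .ref, .cnt, .bad] ∧
      (s'.reg .bad = 0 ↔ SameSlice W p (s.reg .fst) (i - 1)) := by
  have hn := hs.patLen
  have hmm := hs.wordLen
  have hpi := hm i le_rfl
  have c1 := hs.cuts (i - 1) (by omega)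
  have c2 := hs.cuts (s.reg .fst) (by omega)
  have c3 := hs.cuts (s.reg .fst + 1) (by omega)
  have hii : i - 1 + 1 = i := by omega
  have hpm := hm (s.reg .fst + 1) (by omega)
  have hpf := hmono (s.reg .fst) hf
  have hpi' := hmono (i - 1) (by omega)
  rw [hii] at hpi'
  refine Triple.assign_seq (by simp [hn, hmm, hi]; omega) (by simp) ?_
  refine Triple.assign_seq (by simp [hn, hmm]; omega) (by simp) ?_
  refine Triple.assign_seq (by simp) (by simp) ?_
  simp only [cutAddr, Expr.eval, hi, hn, hmm, Store.set_reg, Store.set_mem, c1, c2, hcur,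
    reduceCtorEq, if_false, if_true]
  refine Triple.ite (T' := m * 28 + 4) (by simp [hn, hmm]; omega) ?_ ?_ (by simp)
  · intro h0
    simp [hn, hmm, c3] at h0
    refine Triple.assign (by simp; omega) (by simp) ⟨?_, ?_⟩
    · exact (((((Store.AgreeOff.refl _ _).set (by decide) _).set (by decide) _).set
        (by decide) _).set (by decide) _)
    · simp only [Expr.eval, Store.set_reg, if_true, one_ne_zero, false_iff]
      rintro ⟨h, -⟩
      rw [hii] at h
      omega
  · intro h0
    simp [hn, hmm, c3] at h0
    have hlen : p (s.reg .fst + 1) - p (s.reg .fst) = p i - p (i - 1) := by omega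
    refine Triple.assign_seq (by simp) (by simp) ?_
    -- The letters are compared from the end of the slices to their beginning, so the offsets
    -- already settled are those from `k` on.
    refine Triple.loop (T' := 25) (k := p i - p (i - 1)) (fun k s' =>
      s.AgreeOff s' [.prev, .ref, .cnt, .bad] ∧ s'.reg .prev = p (i - 1) ∧
      s'.reg .ref = p (s.reg .fst) ∧ s'.reg .cnt = k ∧ k ≤ p i - p (i - 1) ∧
      (s'.reg .bad = 0 ↔ ∀ d < p i - p (i - 1), k ≤ d →
        W (p (s.reg .fst) + d) = W (p (i - 1) + d))) ?_ ?_ ?_ ?_ ?_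
    · intros; trivial
    · rintro k s' ⟨h2, h3, h4, h5, h6, h7⟩ h8
      have h8 : s'.reg .cnt ≠ 0 := h8
      obtain ⟨k, rfl⟩ := Nat.exists_eq_succ_of_ne_zero (h5 ▸ h8)
      have hs' := hs.of_agreeOff h2 (by decide) (by decide)
      have w1 := hs'.word (p (s.reg .fst) + k) (by omega)
      have w2 := hs'.word (p (i - 1) + k) (by omega)
      refine Triple.assign_seq (by simp; omega) (by simp) ?_
      refine Triple.ite (T' := 2) ?_ ?_ ?_ (by simp)
      · simp [h5, h4, h3, hs'.patLen]; omega
      · intro h9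
        simp [h5, h4, h3, hs'.patLen, w1, w2] at h9
        refine Triple.assign (by simp; omega) (by simp) ⟨k, by omega,
          (h2.set (by decide) _).set (by decide) _, by simpa using h3, by simpa using h4,
          by simp [h5], by omega, ?_⟩
        simp only [Expr.eval, Store.set_reg, if_true, one_ne_zero, false_iff]
        intro h
        have := h k (by omega) le_rfl
        omega
      · intro h9
        simp [h5, h4, h3, hs'.patLen, w1, w2] at h9
        refine Triple.assign (by simp) (by simp) ⟨k, by omega,
          (h2.set (by decide) _).set (by decide) _, by simpa using h3, by simpa using h4,
          by simp [h5], by omega, ?_⟩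
        simp only [Expr.eval, Store.set_reg, if_true, reduceCtorEq, if_false, h7]
        refine forall₂_congr fun d hd => ⟨fun h hkd => ?_, fun h hkd => h (by omega)⟩
        rcases hkd.eq_or_lt with rfl | hkd
        · omega
        · exact h hkd
    · refine ⟨((((Store.AgreeOff.refl _ _).set (by decide) _).set (by decide) _).set
        (by decide) _).set (by decide) _, by simp, by simp, by simp, le_rfl, ?_⟩
      simp only [Expr.eval, Store.set_reg, if_true, true_iff]
      intros; omega
    · simp; omega
    · rintro k s' ⟨h2, h3, h4, h5, h6, h7⟩ h8
      have h8 : s'.reg .cnt = 0 := h8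
      refine ⟨h2, h7.trans ?_⟩
      rw [SameSlice, hii, hlen]
      exact ⟨fun h => ⟨rfl, fun d hd => h d hd (by omega)⟩, fun h d hd _ => h.2 d hd⟩

/-- The product formed by `mulAdd` ends at the next Horner value, so a bound `X` on Horner values
also bounds its accumulator. -/
theorem triple_addDigit {i t X : ℕ} (hs : Layout A W nx n m p V s) (hi : s.reg .lvl = i)
    (hin : i ≤ n) (ht : s.reg .ptr = t) (hti : t < i)
    (hcode : s.reg .code = horner m (p i) (digits nx n i p t))
    (hflag : s.reg .flag = 0 ↔ ¬ Opened nx n i t)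
    (hX : horner m (p i) (digits nx n i p (t + 1)) ≤ X) (hXB : X ≤ B)
    (hB : 3 * n + 2 * m + 2 ≤ B) :
    Triple B addDigit s (m * 11 + 80) fun s' =>
      s.AgreeOff s' [.code, .flag, .nxt, .acc, .cnt] ∧
      s'.reg .code = horner m (p i) (digits nx n i p (t + 1)) ∧
      (s'.reg .flag = 0 ↔ ¬ Opened nx n i (t + 1)) := by
  have hn := hs.patLen
  have hmm := hs.wordLen
  have hnx := hs.next t (by omega)
  have c1 := hs.cuts t (by omega)
  have c2 := hs.cuts (t + 1) (by omega)
  have hopen : Opened nx n i (t + 1) ↔ Opened nx n i t ∨ (i ≤ nx t ∧ nx t < n) := opened_succ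
  refine Triple.assign_seq (by simp [hn, hmm, ht]; omega) (by simp) ?_
  simp only [nextAddr, Expr.eval, ht, hn, hmm, hnx]
  refine Triple.ite (T' := m * 11 + 64) (by simp) ?_ ?_ (by simp)
  · intro h0
    replace h0 : nx t < i := by simp [hi] at h0; omega
    refine Triple.assign (by simp) (by simp)
      ⟨((Store.AgreeOff.refl _ _).set (by decide) _).set (by decide) _, ?_, ?_⟩
    · simp [hcode, digits, Nat.not_le.2 h0]
    · simp [hflag, hopen, Nat.not_le.2 h0]
  · intro h0
    replace h0 : i ≤ nx t := by simp [hi] at h0; omega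
    refine Triple.seq (T₁ := 7) (T₂ := m * 11 + 57) (R := fun s' => s.AgreeOff s' [.flag, .nxt] ∧
      (s'.reg .flag = 0 ↔ ¬ Opened nx n i (t + 1))) ?_ ?_ (by omega)
    · refine Triple.ite (T' := 2) (by simp) ?_ ?_ (by simp)
      · intro h1
        replace h1 : nx t < n := by simp [hn] at h1; omega
        refine Triple.assign (by simp; omega) (by simp)
          ⟨((Store.AgreeOff.refl _ _).set (by decide) _).set (by decide) _, ?_⟩
        simp [hopen, h0, h1]
      · intro h1
        replace h1 : n ≤ nx t := by simp [hn] at h1; omega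
        refine Triple.assign (by simp) (by simp)
          ⟨((Store.AgreeOff.refl _ _).set (by decide) _).set (by decide) _, ?_⟩
        simp [hflag, hopen, Nat.not_lt.2 h1]
    · rintro s' ⟨h1, h2⟩
      have hcode' : s'.reg .code = horner m (p i) (digits nx n i p t) :=
        (h1.2 .code (by decide)).trans hcode
      have ht' : s'.reg .ptr = t := (h1.2 .ptr (by decide)).trans ht
      have hn' : s'.reg .patLen = n := (h1.2 .patLen (by decide)).trans hn
      have hm' : s'.reg .wordLen = m := (h1.2 .wordLen (by decide)).trans hmm
      have h1' : s.AgreeOff s' [.code, .flag, .nxt, .acc, .cnt] :=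
        (Store.AgreeOff.refl _ _).trans h1 (by decide)
      refine Triple.ite (T' := m * 11 + 54) (by simp) ?_ ?_ (by simp)
      · intro h3
        have h4 : Opened nx n i (t + 1) := by
          by_contra hcon
          exact h3 (h2.2 hcon)
        have hX' := hX
        rw [digits, if_pos ⟨h0, h4⟩, horner_append] at hX'
        rw [Nat.mul_comm] at hX'
        refine Triple.assign_seq (by simp [hn', hm', ht']; omega) (by simp) ?_
        refine Triple.assign_seq (by simp [hm']; omega) (by simp) ?_
        refine Triple.seq (triple_mulAdd ?_ (by omega)) (fun s'' hs'' =>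
          Triple.assign (T := 2) (by simp) (by simp) ⟨?_, ?_, ?_⟩) ?_
        · simp [hn', hm', ht', h1.1, c1, c2, hcode']; omega
        · exact (h1'.trans (((Store.AgreeOff.refl _ _).set (by decide) _).set (by decide) _)
            (List.Subset.refl _) |>.trans hs''.1 (by decide)).set (by decide) _
        · have := hs''.2
          simp [hn', hm', ht', h1.1, c1, c2, hcode'] at this
          simp [this, digits, h0, h4, horner_append]
          ring
        · simp only [Expr.eval, Store.set_reg, reduceCtorEq, if_false]
          rw [hs''.1.2 .flag (by decide)]
          simpa using h2
        · simp [hm']; omega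
      · intro h3
        have h4 : ¬ Opened nx n i (t + 1) := h2.1 h3
        refine Triple.assign (by simp) (by simp) ⟨h1'.set (by decide) _, ?_, by simpa using h2⟩
        simp [hcode', digits, h4]

theorem triple_computeKey {i X : ℕ} (hs : Layout A W nx n m p V s) (hi : s.reg .lvl = i)
    (hin : i ≤ n) (hcur : s.reg .cur = p i)
    (hX : ∀ t ≤ i, horner m (p i) (digits nx n i p t) ≤ X)
    (hB : 3 * n + 2 * m + 2 + (n + 1) * X ≤ B) :
    Triple B computeKey s (n * (m * 11 + 89) + n * 11 + 30) fun s' =>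
      s.AgreeOff s' [.code, .flag, .ptr, .nxt, .acc, .cnt] ∧
      s'.reg .acc = cutKey nx n m i p := by
  have hXB : X ≤ (n + 1) * X := Nat.le_mul_of_pos_left _ (by omega)
  refine Triple.assign_seq (by simp) (by simp) ?_
  refine Triple.assign_seq (by simp) (by simp) ?_
  refine Triple.assign_seq (by simp) (by simp) ?_
  refine Triple.seq (T₁ := n * (m * 11 + 89) + 4) (T₂ := n * 11 + 19) (R := fun s' =>
      s.AgreeOff s' [.code, .flag, .ptr, .nxt, .acc, .cnt] ∧
      s'.reg .code = horner m (p i) (digits nx n i p i)) ?_ ?_ (by simp; omega)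
  · refine Triple.loop (T' := m * 11 + 84) (k := i) (fun k s' =>
      s.AgreeOff s' [.code, .flag, .ptr, .nxt, .acc, .cnt] ∧ s'.reg .ptr + k = i ∧
      s'.reg .code = horner m (p i) (digits nx n i p (s'.reg .ptr)) ∧
      (s'.reg .flag = 0 ↔ ¬ Opened nx n i (s'.reg .ptr))) ?_ ?_ ?_ ?_ ?_
    · intros; simp
    · rintro k s' ⟨h1, h2, h3, h4⟩ h5
      have hi' : s'.reg .lvl = i := (h1.2 .lvl (by decide)).trans hi
      simp only [Expr.eval, hi'] at h5
      refine Triple.seq (triple_addDigit (hs.of_agreeOff h1 (by decide) (by decide)) hi' hin rfl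
        (by omega) h3 h4 (hX _ (by omega)) (by omega) (by omega)) (fun s'' hs'' =>
          Triple.assign (T := 4) ?_ (by simp) ⟨k - 1, by omega, ?_, ?_, ?_, ?_⟩) le_rfl
      · simp [hs''.1.2 .ptr (by decide)]; omega
      · exact (h1.trans hs''.1 (by decide)).set (by decide) _
      · simp [hs''.1.2 .ptr (by decide)]; omega
      · simpa [hs''.1.2 .ptr (by decide)] using hs''.2.1
      · simpa [hs''.1.2 .ptr (by decide)] using hs''.2.2
    · refine ⟨(((Store.AgreeOff.refl _ _).set (by decide) _).set (by decide) _).set (by decide) _,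
        by simp, by simp [hcur, digits, horner], by simp [Opened]⟩
    · have := Nat.mul_le_mul_right (m * 11 + 89) hin
      simpa using this
    · rintro k s' ⟨h1, h2, h3, h4⟩ h5
      have hi' : s'.reg .lvl = i := (h1.2 .lvl (by decide)).trans hi
      simp only [Expr.eval, hi'] at h5
      have h6 : s'.reg .ptr = i := by omega
      rw [h6] at h3
      exact ⟨h1, h3⟩
  · rintro s' ⟨h1, h2⟩
    have hi' : s'.reg .lvl = i := (h1.2 .lvl (by decide)).trans hi
    have hn' : s'.reg .patLen = n := (h1.2 .patLen (by decide)).trans hs.patLen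
    have hXi := Nat.mul_le_mul_left (n + 1) (hX i le_rfl)
    refine Triple.assign_seq (by simp) (by simp) ?_
    refine Triple.assign_seq (by simp [hn']; omega) (by simp) ?_
    refine Triple.mono (triple_mulAdd ?_ (by omega)) ?_ fun s'' hs'' => ⟨?_, ?_⟩
    · simp [hi', hn', h2]; omega
    · simp [hn']; omega
    · exact h1.trans ((((Store.AgreeOff.refl _ [.acc, .cnt]).set (by decide) _).set
        (by decide) _).trans hs''.1 (List.Subset.refl _)) (by decide)
    · simpa [hi', hn', h2, cutKey] using hs''.2

theorem _root_.RAM.Layout.put_cut (hs : Layout A W nx n m p V s) {i : ℕ} (hi : i ≤ n) (x : ℕ) :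
    Layout A W nx n m (Function.update p i x) V (s.put (n + n + m + i) x) := by
  refine ⟨hs.patLen, hs.wordLen, fun t ht => ?_, fun t ht => ?_, fun t ht => ?_, fun t ht => ?_,
    fun t => ?_⟩ <;> rw [Store.put_mem]
  · rw [if_neg (by omega)]; exact hs.pattern t ht
  · rw [if_neg (by omega)]; exact hs.word t ht
  · rw [if_neg (by omega)]; exact hs.next t ht
  · rw [Function.update_apply]
    split_ifs
    · rfl
    · omega
    · omega
    · exact hs.cuts t ht
  · rw [if_neg (by omega)]; exact hs.seen t

theorem _root_.RAM.Layout.put_seen (hs : Layout A W nx n m p V s) (a : ℕ) :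
    Layout A W nx n m p (insert a V) (s.put (n + n + n + m + 1 + a) 1) := by
  refine ⟨hs.patLen, hs.wordLen, fun t ht => ?_, fun t ht => ?_, fun t ht => ?_, fun t ht => ?_,
    fun t => ?_⟩ <;> rw [Store.put_mem]
  · rw [if_neg (by omega)]; exact hs.pattern t ht
  · rw [if_neg (by omega)]; exact hs.word t ht
  · rw [if_neg (by omega)]; exact hs.next t ht
  · rw [if_neg (by omega)]; exact hs.cuts t ht
  · rw [hs.seen t]
    simp only [Nat.add_left_cancel_iff, Finset.mem_insert]
    split_ifs <;> first | rfl | (exfalso; tauto)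

theorem _root_.RAM.Layout.set (hs : Layout A W nx n m p V s) {v : Var} (h1 : v ≠ .patLen)
    (h2 : v ≠ .wordLen) (x : ℕ) : Layout A W nx n m p V (s.set v x) :=
  hs.of_agreeOff ((Store.AgreeOff.refl s [v]).set (List.mem_singleton.2 rfl) x)
    (by simpa using h1.symm) (by simpa using h2.symm)

theorem triple_advance {i x : ℕ} (hs : Layout A W nx n m p V s) (hi : s.reg .lvl = i)
    (hin : i ≤ n) (hx : p i = x) (hB : 2 * n + m + n ≤ B) (hB' : x + 1 ≤ B) :
    Triple B advance s 20 fun s' => s' = s.put (n + n + m + i) (x + 1) := by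
  have h := hs.cuts i hin
  have hn := hs.patLen
  have hm := hs.wordLen
  refine Triple.store ?_ ?_ (by simp) ?_
  · simp [hn, hm, hi]; omega
  · simp [hn, hm, hi, h, hx]; omega
  · simp [hn, hm, hi, h, hx]

/-- The state of the search after some rounds; at most `k` rounds remain. -/
def LoopInv (A W nx : ℕ → ℕ) (n m k : ℕ) (s : Store) : Prop :=
  (∃ i p V, Layout A W nx n m p V s ∧ s.reg .lvl = i ∧ s.reg .ans = 0 ∧
    SearchInv A W nx n m i p V ∧ searchMeasure nx n m i p V < k) ∨
  (s.reg .lvl = 0 ∧ ((s.reg .ans = 1 ∧ ∃ P, IsSolution A W n m P) ∨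
    (s.reg .ans = 0 ∧ ¬ ∃ P, IsSolution A W n m P)))

theorem triple_searchStep {i k X : ℕ} (hnx : IsNext A n nx) (hs : Layout A W nx n m p V s)
    (hi : s.reg .lvl = i) (hans : s.reg .ans = 0) (hinv : SearchInv A W nx n m i p V)
    (hk : searchMeasure nx n m i p V = k)
    (hX : p i ≤ m → ∀ t ≤ i, horner m (p i) (digits nx n i p t) ≤ X)
    (hB : 5 * n + 2 * m + 5 + (n + 1) * X ≤ B) :
    Triple B searchStep s (300 * ((n + 1) * (m + 1))) (LoopInv A W nx n m k) := by
  have hn := hs.patLen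
  have hm := hs.wordLen
  have hi1 := hinv.pos
  have hin := hinv.le
  have hpi := hs.cuts i hin
  have hpb := hinv.bound
  have hT : 300 * ((n + 1) * (m + 1)) = 300 * (n * m) + 300 * n + 300 * m + 300 := by ring
  rw [hT]
  refine Triple.assign_seq (by simp [hn, hm, hi]; omega) (by simp) ?_
  simp only [cutAddr, Expr.eval, hi, hn, hm, hpi]
  set s₁ := s.set .cur (p i) with hs₁
  have hag : s.AgreeOff s₁ [.cur] := (Store.AgreeOff.refl _ _).set (by decide) _
  have hl₁ : Layout A W nx n m p V s₁ := hs.set (by decide) (by decide) _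
  have hn₁ := hl₁.patLen
  have hm₁ := hl₁.wordLen
  have hi₁ : s₁.reg .lvl = i := (hag.2 _ (by decide)).trans hi
  have hans₁ : s₁.reg .ans = 0 := (hag.2 _ (by decide)).trans hans
  have hcur₁ : s₁.reg .cur = p i := by simp [hs₁]
  refine Triple.ite (T' := 300 * (n * m) + 300 * n + 300 * m + 285) (by simp) ?_ ?_
    (by simp)
  · intro h0
    replace h0 : m < p i := by simp [hm₁, hcur₁] at h0; omega
    refine Triple.assign_seq (by simp; omega) (by simp) ?_
    simp only [Expr.eval, hi₁]
    set s₂ := s₁.set .lvl (i - 1) with hs₂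
    have hl₂ : Layout A W nx n m p V s₂ := hl₁.set (by decide) (by decide) _
    have hle := hinv.consistent.le (i - 1) le_rfl
    refine Triple.mono (triple_advance (i := i - 1) hl₂ (by simp [hs₂]) (by omega) rfl (by omega)
      (by omega)) (by simp) ?_
    rintro _ rfl
    rcases hi1.eq_or_lt with rfl | hi2
    · refine .inr ⟨by simp [hs₂], .inr ⟨by simpa [hs₂] using hans₁, ?_⟩⟩
      rintro ⟨P, hP⟩
      exact hinv.not_isSolution h0 P hP
    · obtain ⟨h1, h2⟩ := hinv.pop hnx h0 hi2
      exact .inl ⟨i - 1, _, V, hl₂.put_cut (by omega) _, by simp [hs₂], by simpa [hs₂] using hans₁,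
        h1, hk ▸ h2⟩
  · intro h0
    replace h0 : p i ≤ m := by simp [hm₁, hcur₁] at h0; omega
    have hii : i - 1 + 1 = i := by omega
    have hmono : ∀ t < i, p t ≤ p (t + 1) := by
      intro t ht
      rcases (show t ≤ i - 1 by omega).eq_or_lt with rfl | h
      · rw [hii]; exact hinv.mono
      · exact hinv.consistent.mono t h
    have hle : ∀ t ≤ i, p t ≤ m := by
      intro t ht
      rcases ht.eq_or_lt with rfl | h
      · exact h0
      · exact hinv.consistent.le t (by omega)
    refine Triple.seq (triple_findFirst hl₁ hi₁ hi1 hin (by omega)) (T₂ := 300 * (n * m) +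
      285 * n + 300 * m + 273) ?_ (by omega)
    rintro s₂ ⟨hag₂, hf₂, hfA, hfmin⟩
    have hl₂ := hl₁.of_agreeOff hag₂ (by decide) (by decide)
    have hiff := consistent_succ_iff (W := W) (m := m) (p := p) hf₂ hfA hfmin
    rw [hii] at hiff
    refine Triple.seq (triple_compareSlices hl₂ ((hag₂.2 .lvl (by decide)).trans hi₁) hi1 hin
      ((hag₂.2 .cur (by decide)).trans hcur₁) hmono hle (by omega) (by omega)) (T₂ := 300 * (n * m) +
      285 * n + 272 * m + 203) ?_ (by omega)
    rintro s₃ ⟨hag₃, hbad⟩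
    have hag₃' : s₁.AgreeOff s₃ [.fst, .prev, .ref, .cnt, .bad] :=
      ((Store.AgreeOff.refl _ _).trans hag₂ (by decide)).trans hag₃ (by decide)
    have hl₃ := hl₂.of_agreeOff hag₃ (by decide) (by decide)
    have hc : s₃.reg .bad = 0 ↔ Consistent A W m i p := by
      rw [hbad, hiff]
      exact ⟨fun h => ⟨hinv.consistent, hinv.mono, h0, h⟩, fun h => h.2.2.2⟩
    refine Triple.seq (triple_computeKey hl₃ ((hag₃'.2 .lvl (by decide)).trans hi₁) hin
      ((hag₃'.2 .cur (by decide)).trans hcur₁) (hX h0) (by omega)) (T₂ := 173) ?_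
      (by rw [Nat.mul_add, ← mul_assoc]; omega)
    rintro s₄ ⟨hag₄, hkey⟩
    have hag₄' : s₁.AgreeOff s₄ [.fst, .prev, .ref, .cnt, .bad, .code, .flag, .ptr, .nxt, .acc] :=
      ((Store.AgreeOff.refl _ _).trans hag₃' (by decide)).trans hag₄ (by decide)
    have hl₄ := hl₃.of_agreeOff hag₄ (by decide) (by decide)
    have hn₄ := hl₄.patLen
    have hm₄ := hl₄.wordLen
    have hseen := hl₄.seen (cutKey nx n m i p)
    have hi₄ : s₄.reg .lvl = i := (hag₄'.2 _ (by decide)).trans hi₁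
    have hcur₄ : s₄.reg .cur = p i := (hag₄'.2 _ (by decide)).trans hcur₁
    have hans₄ : s₄.reg .ans = 0 := (hag₄'.2 _ (by decide)).trans hans₁
    have hbad₄ : s₄.reg .bad = s₃.reg .bad := hag₄.2 _ (by decide)
    have hkB : cutKey nx n m i p ≤ n + (n + 1) * X :=
      Nat.add_le_add hin (Nat.mul_le_mul_left _ (hX h0 i le_rfl))
    have skip : ∀ T, 20 ≤ T → (∀ P, IsSolution A W n m P → ¬ ∀ l ≤ i, P l = p l) →
        Triple B advance s₄ T (LoopInv A W nx n m k) := by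
      intro T hT hd
      refine Triple.mono (triple_advance hl₄ hi₄ hin rfl (by omega) (by omega)) hT ?_
      rintro _ rfl
      obtain ⟨h1, h2⟩ := hinv.skip h0 hd
      exact .inl ⟨i, _, V, hl₄.put_cut hin _, by simpa using hi₄, by simpa using hans₄,
        h1, hk ▸ h2⟩
    refine Triple.ite (T' := 150) (by simp [hn₄, hm₄, hkey]; omega) ?_ ?_ (by simp)
    · intro h1
      simp [hn₄, hm₄, hkey, hseen] at h1
      have hV : cutKey nx n m i p ∉ V := fun h => by rw [if_pos h] at h1; omega
      have hcons : Consistent A W m i p := hc.1 (by rw [← hbad₄]; omega)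
      refine Triple.ite (T' := 100) (by simp) ?_ ?_ (by simp)
      · intro h2
        replace h2 : i < n := by simp [hn₄, hi₄] at h2; omega
        obtain ⟨h3, h4⟩ := hinv.push hcons hV h2
        refine Triple.store_seq (by simp [hn₄, hm₄, hkey]; omega) (by simp; omega) (by simp) ?_
        refine Triple.assign_seq (by simp [hi₄]; omega) (by simp) ?_
        refine Triple.store (by simp [hn₄, hm₄, hi₄]; omega) (by simp) (by simp) ?_
        simp only [seenAddr, Expr.eval, hn₄, hm₄, hi₄, hkey, Store.put_reg,
          Store.set_reg, if_true, reduceCtorEq, if_false, hcur₄]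
        refine .inl ⟨i + 1, _, _, ((hl₄.put_seen _).set (by decide) (by decide) _).put_cut h2 _,
          by simp, by simpa using hans₄, h3, hk ▸ h4⟩
      · intro h2
        replace h2 : i = n := by simp [hn₄, hi₄] at h2; omega
        refine Triple.ite (T' := 50) (by simp) ?_ ?_ (by simp)
        · intro h3
          simp [hm₄, hcur₄] at h3
          -- At level n the cuts are complete but miss the end of the word, so no key has to be
          -- stored to reject them.
          refine skip _ (by simp) fun P hP hPp => ?_
          have h4 := hPp i le_rfl
          rw [h2, hP.last, ← h2] at h4
          omega
        · intro h3
          simp [hm₄, hcur₄] at h3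
          refine Triple.assign_seq (by simp; omega) (by simp) ?_
          refine Triple.assign (by simp) (by simp) (.inr ⟨by simp, .inl ⟨by simp, p, ?_, ?_⟩⟩)
          · exact h2 ▸ hcons
          · rw [← h2]; omega
    · intro h1
      simp [hn₄, hm₄, hkey, hseen] at h1
      refine skip _ (by simp) (hinv.not_extendable fun hcons => ?_)
      by_contra hV
      rw [if_neg hV, hbad₄, hc.2 hcons] at h1
      omega

theorem _root_.SearchInv.horner_digits_le {i k : ℕ} (h : SearchInv A W nx n m i p V)
    (hnx : IsNext A n nx) (hk : SeparatedBy A n k) (hp : p i ≤ m) {t : ℕ} (ht : t ≤ i) :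
    horner m (p i) (digits nx n i p t) ≤ (m + 1) ^ (k + 2) := by
  have hi := h.pos
  have hmono : ∀ s < t, p s ≤ p (s + 1) := by
    intro s hs
    rcases (show s + 1 ≤ i by omega).eq_or_lt with h1 | h1
    · have := h.mono
      rwa [← h1, Nat.add_sub_cancel] at this
    · exact h.consistent.mono s (by omega)
  have h1 := sum_digits_le (nx := nx) (n := n) (i := i) hmono
  have h2 : p t ≤ m := by
    rcases ht.eq_or_lt with rfl | ht
    · exact hp
    · exact h.consistent.le t (by omega)
  refine (horner_lt hp fun d hd => ?_).le.trans (Nat.pow_le_pow_right (by omega)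
    (Nat.succ_le_succ (length_digits_le hnx hk h.le ht)))
  have := List.le_sum_of_mem hd
  omega

theorem triple_search {k K : ℕ} (hn : 1 ≤ n) (hnx : IsNext A n nx)
    (hs : Layout A W nx n m (fun _ => 0) ∅ s) (hi : s.reg .lvl = 1) (hans : s.reg .ans = 0)
    (hk : SeparatedBy A n k) (hB : 5 * n + 2 * m + 5 + (n + 1) * (m + 1) ^ (k + 2) ≤ B)
    (hK : ((keySet nx n m).card + 1) * ((m + 3) * ((n + 1) * (m + 1))) ≤ K) :
    Triple B (.loop (.var .lvl) searchStep) s (303 * K + 2) fun s' =>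
      (s'.reg .ans = 1 ∧ ∃ P, IsSolution A W n m P) ∨
        (s'.reg .ans = 0 ∧ ¬ ∃ P, IsSolution A W n m P) := by
  refine Triple.loop (LoopInv A W nx n m) (T' := 300 * ((n + 1) * (m + 1)))
    (k := ((keySet nx n m).card + 1) * (m + 3)) (fun _ _ _ => trivial) ?_ ?_ ?_ ?_
  · rintro j s' (⟨i, p, V, h1, h2, h3, h4, h5⟩ | ⟨h1, -⟩) h0
    · refine Triple.mono (triple_searchStep hnx h1 h2 h3 h4 rfl
        (fun hp t ht => h4.horner_digits_le hnx hk hp ht) hB) le_rfl fun s'' h => ⟨_, h5, h⟩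
    · exact absurd h1 h0
  · refine .inl ⟨1, _, _, hs, hi, hans, searchInv_init hn rfl rfl, ?_⟩
    rw [searchMeasure_init rfl, Nat.succ_mul]
    omega
  · have h1 : 1 ≤ (n + 1) * (m + 1) := Nat.mul_pos (by omega) (by omega)
    calc _ ≤ ((keySet nx n m).card + 1) * (m + 3) * (303 * ((n + 1) * (m + 1))) + 2 := by
          refine Nat.add_le_add (Nat.mul_le_mul_left _ ?_) (by simp)
          simp only [Expr.size]
          omega
      _ = 303 * (((keySet nx n m).card + 1) * ((m + 3) * ((n + 1) * (m + 1)))) + 2 := by ring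
      _ ≤ _ := by omega
  · rintro j s' (⟨i, p, V, h1, h2, h3, h4, h5⟩ | ⟨-, h⟩) h0
    · have := h4.pos
      simp [h2] at h0
      omega
    · exact h

theorem triple_tabulateNext (hn : s.reg .patLen = n) (hm : s.reg .wordLen = m)
    (hB : 3 * n + m + 2 ≤ B) :
    Triple B tabulateNext s (n * (n * 21 + 36) + 6) fun s' =>
      s'.reg .patLen = n ∧ s'.reg .wordLen = m ∧
      (∀ a, a < n + m ∨ n + m + n ≤ a → s'.mem a = s.mem a) ∧
      IsNext s.mem n fun t => s'.mem (n + m + t) := by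
  refine Triple.assign_seq (by simp) (by simp) ?_
  refine Triple.loop (T' := n * 21 + 31) (k := n) (fun k s' =>
      (s'.reg .patLen = n ∧ s'.reg .wordLen = m ∧
      ∀ a, a < n + m ∨ n + m + n ≤ a → s'.mem a = s.mem a) ∧ s'.reg .ptr + k = n ∧
      ∀ t < s'.reg .ptr, t < s'.mem (n + m + t) ∧ s'.mem (n + m + t) ≤ n ∧
        (∀ v, t < v → v < s'.mem (n + m + t) → s.mem v ≠ s.mem t) ∧
        (s'.mem (n + m + t) < n → s.mem (s'.mem (n + m + t)) = s.mem t)) ?_ ?_ ?_ ?_ ?_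
  · intros; simp
  · rintro k s' ⟨⟨h1, h2, h3⟩, h4, h5⟩ h6
    simp only [Expr.eval, h1] at h6
    set t := s'.reg .ptr with ht
    refine Triple.assign_seq (by simp; omega) (by simp) ?_
    refine Triple.seq (T₁ := n * 21 + 16) (T₂ := 11) (R := fun s'' => s'.AgreeOff s'' [.nxt] ∧
        t < s''.reg .nxt ∧ s''.reg .nxt ≤ n ∧
        (∀ v, t < v → v < s''.reg .nxt → s.mem v ≠ s.mem t) ∧
        (s''.reg .nxt < n → s.mem (s''.reg .nxt) = s.mem t)) ?_ ?_ (by simp)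
    · have val : ∀ s'', s'.AgreeOff s'' [.nxt] → s''.reg .patLen = n ∧
          s''.mem (s''.reg .ptr) = s.mem t ∧
          (s''.reg .nxt < n → s''.mem (s''.reg .nxt) = s.mem (s''.reg .nxt)) := by
        intro s'' h
        rw [h.1, h.2 .patLen (by decide), h.2 .ptr (by decide)]
        exact ⟨h1, h3 _ (by omega), fun h => h3 _ (by omega)⟩
      refine Triple.loop (T' := 4) (k := n) (fun k s'' => s'.AgreeOff s'' [.nxt] ∧
        t < s''.reg .nxt ∧ s''.reg .nxt ≤ n ∧ n ≤ s''.reg .nxt + k ∧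
        (∀ v, t < v → v < s''.reg .nxt → s.mem v ≠ s.mem t)) ?_ ?_ ?_ ?_ ?_
      · intros; simp
      · rintro j s'' ⟨g1, g2, g3, g4, g5⟩ g6
        obtain ⟨e1, e2, e3⟩ := val s'' g1
        simp only [Expr.eval, e1, e2] at g6
        have g7 : s''.reg .nxt < n := by omega
        rw [e3 g7] at g6
        have g8 : s.mem (s''.reg .nxt) ≠ s.mem t := by omega
        refine Triple.assign (by simp; omega) (by simp) ⟨j - 1, by omega,
          g1.set (by decide) _, by simp; omega, by simp; omega, by simp; omega, ?_⟩
        simp only [Expr.eval, Store.set_reg, if_true]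
        intro v hv hv'
        rcases (Nat.lt_succ_iff.1 hv').eq_or_lt with rfl | hv'
        exacts [g8, g5 v hv hv']
      · refine ⟨(Store.AgreeOff.refl _ _).set (by decide) _, ?_⟩
        simp [← ht]
        exact ⟨by omega, fun v hv hv' => by omega⟩
      · simp
      · rintro j s'' ⟨g1, g2, g3, g4, g5⟩ g6
        obtain ⟨e1, e2, e3⟩ := val s'' g1
        simp only [Expr.eval, e1, e2] at g6
        refine ⟨g1, g2, g3, g5, fun h => ?_⟩
        rw [e3 h] at g6
        omega
    · rintro s'' ⟨g1, g2, g3, g4, g5⟩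
      have e1 : s''.reg .patLen = n := (g1.2 _ (by decide)).trans h1
      have e2 : s''.reg .wordLen = m := (g1.2 _ (by decide)).trans h2
      have e3 : s''.reg .ptr = t := g1.2 _ (by decide)
      refine Triple.store_seq (by simp [e1, e2, e3]; omega) (by simp) (by simp) ?_
      refine Triple.assign (by simp [e3]; omega) (by simp) ⟨k - 1, by omega, ⟨by simpa using e1,
        by simpa using e2, fun a ha => ?_⟩, ?_, ?_⟩
      · simp only [nextAddr, Expr.eval, e1, e2, e3, Store.set_mem, Store.put_mem]
        rw [if_neg (by omega), g1.1, h3 a ha]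
      · simp [e3]; omega
      · simp only [nextAddr, Expr.eval, e1, e2, e3, Store.set_mem, Store.put_mem, Store.set_reg,
          if_true, Store.put_reg]
        intro r hr
        rcases (Nat.lt_succ_iff.1 hr).eq_or_lt with rfl | hr
        · simp only [if_true]
          exact ⟨g2, g3, g4, g5⟩
        · simp only [Nat.add_left_cancel_iff, if_neg hr.ne, g1.1]
          exact h5 r hr
  · exact ⟨⟨by simpa using hn, by simpa using hm, fun a _ => rfl⟩, by simp, by simp⟩
  · simp
  · rintro k s' ⟨⟨h1, h2, h3⟩, h4, h5⟩ h6
    simp only [Expr.eval, h1] at h6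
    exact ⟨h1, h2, h3, fun t ht => h5 t (by omega)⟩

theorem IsNext.congr {A' : ℕ → ℕ} (h : IsNext A n nx) (hA : ∀ t < n, A' t = A t) :
    IsNext A' n nx := by
  intro t ht
  obtain ⟨h1, h2, h3, h4⟩ := h t ht
  refine ⟨h1, h2, fun v hv hv' => ?_, fun h5 => ?_⟩
  · rw [hA v (by omega), hA t ht]; exact h3 v hv hv'
  · rw [hA _ h5, hA t ht]; exact h4 h5

open Classical in
theorem triple_matchTest {k : ℕ} (hn0 : 1 ≤ n) (hn : s.reg .patLen = n) (hm : s.reg .wordLen = m)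
    (hA : ∀ t < n, s.mem t = A t) (hW : ∀ b < m, s.mem (n + b) = W b)
    (h0 : ∀ a, n + m ≤ a → s.mem a = 0) (hk : SeparatedBy A n k) (hkn : k ≤ n)
    (hB : 5 * n + 2 * m + 5 + (n + 1) * (m + 1) ^ (k + 2) ≤ B) :
    Triple B matchTest s (61000 * n ^ 3 * (max 1 m) ^ (k + 4)) fun s' =>
      s'.reg .patLen = if ∃ P, IsSolution A W n m P then 1 else 0 := by
  -- The search contributes 303 · 200 = 60600; the rest of 61000 absorbs the quadratic tabulation
  -- and the assignments.
  have hT : n * (n * 21 + 36) + 6 + (303 * (200 * n ^ 3 * (max 1 m) ^ (k + 4)) + 8) ≤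
      61000 * n ^ 3 * (max 1 m) ^ (k + 4) := by
    have h1 : 1 ≤ (max 1 m) ^ (k + 4) := Nat.one_le_pow _ _ (by omega)
    have h2 : n ≤ n ^ 3 := Nat.le_self_pow (by norm_num) n
    have h3 : n ^ 2 ≤ n ^ 3 := Nat.pow_le_pow_right hn0 (by norm_num)
    have h4 : n ^ 3 ≤ n ^ 3 * (max 1 m) ^ (k + 4) := Nat.le_mul_of_pos_right _ h1
    have h5 : n * (n * 21 + 36) = 21 * n ^ 2 + 36 * n := by ring
    rw [h5, mul_assoc 200, mul_assoc 61000]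
    omega
  refine Triple.seq (triple_tabulateNext hn hm (by omega)) ?_ hT
  rintro s₁ ⟨hn₁, hm₁, hmem, hnx⟩
  have hnx' : IsNext A n fun t => s₁.mem (n + m + t) :=
    IsNext.congr hnx fun t ht => (hA t ht).symm
  refine Triple.assign_seq (by simp; omega) (by simp) ?_
  refine Triple.assign_seq (by simp) (by simp) ?_
  -- Memory beyond the input is initially zero, so all cuts start at 0 and the table of keys starts
  -- empty without any initialisation.
  have hl : Layout A W (fun t => s₁.mem (n + m + t)) n m (fun _ => 0) ∅ s₁ := by
    refine ⟨hn₁, hm₁, fun t ht => ?_, fun t ht => ?_, fun t ht => rfl, fun t ht => ?_, fun t => ?_⟩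
    · rw [hmem _ (by omega), hA t ht]
    · rw [hmem _ (by omega), hW t ht]
    · rw [hmem _ (by omega), h0 _ (by omega)]
    · rw [hmem _ (by omega), h0 _ (by omega)]; rfl
  refine Triple.seq (triple_search hn0 hnx' ((hl.set (by decide) (by decide) _).set (by decide)
    (by decide) _) (by simp) (by simp) hk hB (card_keySet_le_pow hnx' hk hkn hn0))
    (T₂ := 2) ?_ (by simp)
  rintro s₂ (⟨h1, h2⟩ | ⟨h1, h2⟩)
  · exact Triple.assign (by simp) (by simp) (by simp [h1, if_pos h2])
  · exact Triple.assign (by simp) (by simp)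
      (by simp only [Store.set_reg, if_true, Expr.eval, h1, if_neg h2])

end Search

end RAM

/-! ### Patterns and words as lists -/

theorem separatesAtMost_variableDistance (α : List ℕ) :
    SeparatesAtMost α (variableDistance α) :=
  Nat.sInf_mem (s := {k | SeparatesAtMost α k}) ⟨_, separatesAtMost_length α⟩

theorem variableDistance_le_length (α : List ℕ) : variableDistance α ≤ α.length :=
  Nat.sInf_le (separatesAtMost_length α)

theorem SeparatesAtMost.separatedBy {α : List ℕ} {k : ℕ} (h : SeparatesAtMost α k) :
    SeparatedBy (fun t => α.getD t 0) α.length k := by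
  intro s u hsu hu hA hne
  have hs : s < α.length := by omega
  simp only [List.getD_eq_getElem α 0 hs, List.getD_eq_getElem α 0 hu] at hA
  set γ := (α.drop (s + 1)).take (u - (s + 1)) with hγ
  have hget : ∀ v, s < v → v < u → α.getD v 0 ∈ γ := by
    intro v hv hvu
    rw [List.getD_eq_getElem α 0 (by omega)]
    refine List.mem_iff_getElem.2 ⟨v - (s + 1), by simp [hγ]; omega, ?_⟩
    simp only [hγ, List.getElem_take, List.getElem_drop]
    congr 1
    omega
  have hdec : α = α.take s ++ [α[s]] ++ γ ++ [α[s]] ++ α.drop (u + 1) := by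
    have h1 : α.drop (s + 1) = γ ++ ([α[s]] ++ α.drop (u + 1)) := by
      rw [hA, List.singleton_append, ← List.drop_eq_getElem_cons hu]
      conv_lhs => rw [← List.take_append_drop (u - (s + 1)) (α.drop (s + 1))]
      rw [List.drop_drop, show s + 1 + (u - (s + 1)) = u by omega]
    rw [List.append_assoc, List.append_assoc, ← h1, List.append_assoc, List.singleton_append,
      ← List.drop_eq_getElem_cons hs, List.take_append_drop]
  have hnot : α[s] ∉ γ := by
    intro hmem
    obtain ⟨j, hj, hj'⟩ := List.mem_iff_getElem.1 hmem
    have hj2 : j < u - (s + 1) := by simp [hγ] at hj; omega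
    simp only [hγ, List.getElem_take, List.getElem_drop] at hj'
    refine hne (s + 1 + j) (by omega) (by omega) ?_
    simp only
    rw [List.getD_eq_getElem α 0 hs, ← hj', List.getD_eq_getElem α 0 (by omega)]
  refine (Finset.card_le_card fun x hx => ?_).trans (h _ _ _ _ hdec hnot)
  obtain ⟨v, hv, rfl⟩ := Finset.mem_image.1 hx
  rw [Finset.mem_Ioo] at hv
  exact List.mem_toFinset.2 (hget v hv.1 hv.2)

section Link

variable {s : ℕ} {α : List ℕ} {w : List (Fin s)}

theorem length_wordCode : (wordCode w).length = w.length := List.length_map _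

/-- The cut before place t is the length of the image of the prefix of length t. -/
theorem exists_isSolution_of_mem (h : w ∈ patternLanguage (Fin s) α) :
    ∃ P, IsSolution (fun t => α.getD t 0) (fun t => (wordCode w).getD t 0) α.length w.length P := by
  obtain ⟨σ, hσ, rfl⟩ := h
  have hnil : σ [] = [] := by
    have := congrArg List.length (hσ [] [])
    simp only [List.append_nil, List.length_append] at this
    exact List.length_eq_zero_iff.1 (by omega)
  have hsucc : ∀ t (ht : t < α.length), σ (α.take (t + 1)) = σ (α.take t) ++ σ [α[t]] := by
    intro t ht
    rw [List.take_succ_eq_append_getElem ht, hσ]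
  have hlen : ∀ t (ht : t < α.length), (σ (α.take (t + 1))).length - (σ (α.take t)).length =
      (σ [α[t]]).length := by
    intro t ht
    rw [hsucc t ht, List.length_append, Nat.add_sub_cancel_left]
  have hval : ∀ t (ht : t < α.length), ∀ d < (σ [α[t]]).length,
      (wordCode (σ α)).getD ((σ (α.take t)).length + d) 0 = (wordCode (σ [α[t]])).getD d 0 := by
    intro t ht d hd
    have h1 : σ α = σ (α.take t) ++ (σ [α[t]] ++ σ (α.drop (t + 1))) := by
      rw [← hσ, ← hσ, List.singleton_append, ← List.drop_eq_getElem_cons ht,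
        List.take_append_drop]
    have h2 : d < (wordCode (σ [α[t]])).length := by rwa [length_wordCode]
    rw [h1, wordCode, List.map_append, List.map_append,
      List.getD_append_right _ _ _ _ (by rw [List.length_map]; omega), List.length_map,
      Nat.add_sub_cancel_left, ← wordCode, List.getD_append _ _ _ _ h2]
  refine ⟨fun t => (σ (α.take t)).length, ⟨by simp [hnil], fun t ht => ?_, fun t ht => ?_,
    fun t ht u hu htu => ?_⟩, by simp⟩
  · simp only [hsucc t ht, List.length_append]; omega
  · conv_rhs => rw [← List.take_append_drop t α, hσ, List.length_append]
    omega
  · simp only [List.getD_eq_getElem α 0 ht, List.getD_eq_getElem α 0 hu] at htu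
    refine ⟨?_, fun d hd => ?_⟩
    · simp only [hlen t ht, hlen u hu, htu]
    · simp only [hlen t ht] at hd
      simp only
      rw [hval t ht d hd, hval u hu d (htu ▸ hd), htu]

theorem mem_of_isSolution {P : ℕ → ℕ}
    (h : IsSolution (fun t => α.getD t 0) (fun t => (wordCode w).getD t 0) α.length w.length P) :
    w ∈ patternLanguage (Fin s) α := by
  classical
  obtain ⟨hc, hlast⟩ := h
  set slice : ℕ → List (Fin s) := fun t => (w.drop (P t)).take (P (t + 1) - P t) with hslice
  have hlen : ∀ t < α.length, (slice t).length = P (t + 1) - P t := by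
    intro t ht
    have h1 := hc.le (t + 1) ht
    simp [hslice]
    omega
  have hsame : ∀ t < α.length, ∀ u < α.length, α.getD t 0 = α.getD u 0 → slice t = slice u := by
    intro t ht u hu htu
    obtain ⟨h1, h2⟩ := hc.same t ht u hu htu
    refine List.ext_getElem (by rw [hlen t ht, hlen u hu, h1]) fun d hd hd' => ?_
    rw [hlen t ht] at hd
    rw [hlen u hu] at hd'
    have h3 := hc.le (t + 1) ht
    have h4 := hc.le (u + 1) hu
    have h5 := h2 d hd
    simp only at h5
    rw [List.getD_eq_getElem _ 0 (by rw [length_wordCode]; omega),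
      List.getD_eq_getElem _ 0 (by rw [length_wordCode]; omega)] at h5
    simp only [wordCode, List.getElem_map] at h5
    simpa [hslice] using Fin.val_injective h5
  -- Any occurrence may define the image of its variable, since all its slices agree; variables
  -- absent from the pattern are erased.
  set φ : ℕ → List (Fin s) := fun x =>
    if hx : ∃ t, t < α.length ∧ α.getD t 0 = x then slice hx.choose else [] with hφ
  have hφs : ∀ t (ht : t < α.length), φ α[t] = slice t := by
    intro t ht
    have hx : ∃ u, u < α.length ∧ α.getD u 0 = α[t] := ⟨t, ht, List.getD_eq_getElem α 0 ht⟩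
    simp only [hφ, dif_pos hx]
    refine hsame _ hx.choose_spec.1 t ht (hx.choose_spec.2.trans ?_)
    rw [List.getD_eq_getElem α 0 ht]
  refine ⟨fun u => u.flatMap φ, fun u v => List.flatMap_append, ?_⟩
  have key : ∀ t ≤ α.length, (α.take t).flatMap φ = w.take (P t) := by
    intro t
    induction t with
    | zero => simp [hc.zero]
    | succ t ih =>
      intro ht
      have h1 := hc.mono t ht
      rw [List.take_succ_eq_append_getElem ht, List.flatMap_append, ih (by omega),
        List.flatMap_singleton, hφs t ht, ← Nat.add_sub_cancel' h1, List.take_add]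
  have := key α.length le_rfl
  rwa [List.take_length, hlast, List.take_length] at this

theorem exists_isSolution_iff : (∃ P, IsSolution (fun t => α.getD t 0)
    (fun t => (wordCode w).getD t 0) α.length w.length P) ↔ w ∈ patternLanguage (Fin s) α :=
  ⟨fun ⟨_, h⟩ => mem_of_isSolution h, exists_isSolution_of_mem⟩

end Link

/-! ### The compiled program and its bounds -/

theorem decidesMembershipWithin_mono {P : RAM.Program} {α : List ℕ} {s : ℕ} {w : List (Fin s)}
    {T T' B B' : ℕ} (h : DecidesMembershipWithin P α w T B) (hT : T ≤ T') (hB : B ≤ B') :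
    DecidesMembershipWithin P α w T' B' := by
  obtain ⟨t, ht, h1, h2, h3⟩ := h
  exact ⟨t, ht.trans hT, h1, h2, fun u hu a =>
    ⟨(h3 u hu a).1.trans hB, (h3 u hu a).2.trans hB⟩⟩

/-- The compiled membership test. -/
def matchProgram : RAM.Program := RAM.Search.matchTest.code 0

theorem matchProgram_decides {s : ℕ} {α : List ℕ} {w : List (Fin s)} {N B : ℕ} (hα : α ≠ [])
    (hN : InputBoundedBy α (wordCode w) N) (hNB : N ≤ B)
    (hB : 5 * α.length + 2 * w.length + 5 +
      (α.length + 1) * (w.length + 1) ^ (variableDistance α + 2) ≤ B) :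
    DecidesMembershipWithin matchProgram α w
      (61000 * α.length ^ 3 * (max 1 w.length) ^ (variableDistance α + 4)) B := by
  classical
  obtain ⟨hN1, hN2, hN3, hN4⟩ := hN
  set c := RAM.init α (wordCode w) with hc
  have hn : 1 ≤ α.length := List.length_pos_iff.2 hα
  have hlen : (wordCode w).length = w.length := length_wordCode
  have hmem : ∀ a, c.mem a ≤ N := by
    intro a
    simp only [hc, RAM.init]
    rcases lt_or_ge a (α ++ wordCode w).length with h | h
    · rw [List.getD_eq_getElem _ 0 h]
      rcases List.mem_append.1 (List.getElem_mem h) with h | h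
      exacts [hN3 _ h, hN4 _ h]
    · rw [List.getD_eq_default _ _ h]; exact Nat.zero_le _
  have hbd : RAM.Config.Bounded B c := by
    refine fun a => ⟨?_, (hmem a).trans hNB⟩
    simp only [hc, RAM.init]
    split_ifs
    exacts [hN1.trans hNB, hN2.trans hNB, Nat.zero_le _]
  have h := RAM.Search.triple_matchTest (A := fun t => α.getD t 0)
    (W := fun t => (wordCode w).getD t 0) (n := α.length) (m := w.length)
    (s := ⟨fun v => c.reg v.idx, c.mem⟩) (B := B) hn rfl hlen
    (fun t ht => List.getD_append _ _ _ _ ht)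
    (fun b _ => by
      simp only [hc, RAM.init]
      rw [List.getD_append_right _ _ _ _ (by omega), Nat.add_sub_cancel_left])
    (fun a ha => List.getD_eq_default _ _ (by rw [List.length_append, hlen]; exact ha))
    (separatesAtMost_variableDistance α).separatedBy (variableDistance_le_length α) hB
  obtain ⟨t, ht, y, s', hy, hyp, hys, hout⟩ := h matchProgram c (RAM.codeAt_self _)
    ⟨fun _ => rfl, rfl⟩ hbd
  refine ⟨t, ht, ?_, ?_, fun u hu => hy.2 u hu⟩
  · rw [hy.1, RAM.Halted, hyp]
    simp [matchProgram]
  · rw [hy.1]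
    have h1 := hys.reg .patLen
    rw [hout] at h1
    refine h1.trans ?_
    simp only [exists_isSolution_iff]

/-- Since N ≥ 2, a factor m + 1 is at most N², and constants can be absorbed into powers of N. -/
theorem space_bound {n m N k : ℕ} (hN : 2 ≤ N) (hn : n ≤ N) (hm : m ≤ N) :
    5 * n + 2 * m + 5 + (n + 1) * (m + 1) ^ (k + 2) ≤ N ^ (2 * k + 7) := by
  have hN2 : N + 1 ≤ N ^ 2 := by nlinarith
  have h1 : (n + 1) * (m + 1) ^ (k + 2) ≤ N ^ (2 * k + 6) := by
    calc _ ≤ N ^ 2 * (N ^ 2) ^ (k + 2) := by gcongr <;> omega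
      _ = _ := by rw [← pow_mul, ← pow_add]; congr 1; ring
  have h2 : 5 * n + 2 * m + 5 ≤ N ^ (2 * k + 6) := by
    calc 5 * n + 2 * m + 5 ≤ 16 * N := by omega
      _ ≤ N ^ 4 * N := by gcongr; exact Nat.pow_le_pow_left hN 4
      _ = N ^ 5 := by ring
      _ ≤ _ := Nat.pow_le_pow_right (by omega) (by omega)
  calc _ ≤ 2 * N ^ (2 * k + 6) := by omega
    _ ≤ N * N ^ (2 * k + 6) := Nat.mul_le_mul_right _ hN
    _ = N ^ (2 * k + 7) := by ring

theorem matchProgram_decides_pow {s : ℕ} {α : List ℕ} {w : List (Fin s)} {N : ℕ} (hα : α ≠ [])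
    (hN2 : 2 ≤ N) (hN : InputBoundedBy α (wordCode w) N) :
    DecidesMembershipWithin matchProgram α w
      (61000 * α.length ^ 3 * (max 1 w.length) ^ (variableDistance α + 4))
      (N ^ (2 * variableDistance α + 7)) :=
  matchProgram_decides hα hN (Nat.le_self_pow (by omega) N)
    (space_bound hN2 hN.1 (length_wordCode (w := w) ▸ hN.2.1))

theorem mainTheorem1 :
    ∃ P : RAM.Program,
      (∃ C : ℕ, ∀ (s : ℕ) (α : List ℕ) (w : List (Fin s)) (N : ℕ),
        α ≠ [] → 2 ≤ N → InputBoundedBy α (wordCode w) N →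
          DecidesMembershipWithin P α w
            (C * α.length ^ 3 * (max 1 w.length) ^ (variableDistance α + 4))
            (N ^ (C * (variableDistance α + 1)))) ∧
      (∀ k : ℕ, ∃ d : ℕ, ∀ (s : ℕ) (α : List ℕ) (w : List (Fin s)) (N : ℕ),
        α ≠ [] → variableDistance α ≤ k → 2 ≤ N → InputBoundedBy α (wordCode w) N →
          DecidesMembershipWithin P α w
            (d * (α.length + w.length) ^ d)
            (N ^ d)) := by
  refine ⟨matchProgram, ⟨61000, fun s α w N hα hN2 hN => ?_⟩, fun k =>
    -- This d covers the coefficient 61000, the time exponent k + 7 and the space exponent 2k + 7.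
    ⟨61000 + 2 * k, fun s α w N hα hk hN2 hN => ?_⟩⟩
  · exact decidesMembershipWithin_mono (matchProgram_decides_pow hα hN2 hN) le_rfl
      (Nat.pow_le_pow_right (by omega) (by omega))
  · refine decidesMembershipWithin_mono (matchProgram_decides_pow hα hN2 hN) ?_
      (Nat.pow_le_pow_right (by omega) (by omega))
    have hn : 1 ≤ α.length := List.length_pos_iff.2 hα
    generalize hM : α.length + w.length = M
    calc _ ≤ 61000 * M ^ 3 * M ^ (k + 4) := by
          refine Nat.mul_le_mul (Nat.mul_le_mul_left _ (Nat.pow_le_pow_left (by omega) 3))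
            ((Nat.pow_le_pow_left (by omega) _).trans (Nat.pow_le_pow_right (by omega) (by omega)))
      _ = 61000 * M ^ (k + 7) := by ring
      _ ≤ (61000 + 2 * k) * M ^ (61000 + 2 * k) :=
          Nat.mul_le_mul (by omega) (Nat.pow_le_pow_right (by omega) (by omega))
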